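/- **Setting.** Let $n,k\ge 0$ be integers and $d=2^n$. Consider $k$ blocks of $n$ qubits; for each $i\le k$ let $\mathcal S_i$ be the stabilizer group of an $[[n,1]]$ stabilizer code on block $i$ (an abelian subgroup of the $n$-qubit Pauli group with $-\mathbb 1\notin\mathcal S_i$ and $|\mathcal S_i|=2^{n-1}$), with code projector $P_i=|\mathcal S_i|^{-1}\sum_{g\in\mathcal S_i}g$, and put $\Pi=P_1\otimes\cdots\otimes P_k$. A *logical Pauli observable* is an operator $O=\pm(\text{Pauli string on all } nk \text{ qubits})$ with $[\Pi,O]=0$. Let $\mathcal{C}\ell(d)$ be the $n$-qubit Clifford group (the normalizer of the Pauli group in $U(d)$, modulo global phases). One *sample* of a state $\rho$ on the $nk$ qubits is a pair $(U,b)$, where $U=U_1\otimes\cdots\otimes U_k$ is uniform in $\mathcal{C}\ell(d)^{\otimes k}$ and $b$ is the outcome of measuring $U\rho U^\dagger$ in the computational basis. Let $\mathcal M(A)=\mathbb E_U\sum_b\langle b|UAU^\dagger|b\rangle\,U^\dagger|b\rangle\langle b|U$, let $\hat\rho=\mathcal M^{-1}(U^\dagger|b\rangle\langle b|U)$ be the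 classical shadow of a sample, $\hat o=\operatorname{Tr}(\Pi\hat\rho\,\Pi O)$ its single-shot value for an observable $O$, and $$\|A\|_{\text{shadow}}=\max_{\sigma\text{ state}}\Big(\mathbb E_U\sum_b\langle b|U\sigma U^\dagger|b\rangle\,\big|\langle b|U\mathcal M^{-1}(A)U^\dagger|b\rangle\big|^2\Big)^{1/2}.$$ **Theorem (sample complexity of logical shadow tomography).** 1. The map $\mathcal M$ is invertible, and for every logical Pauli observable $O$, $$\|\Pi O\|_{\text{shadow}}^2\le\Big(\frac{2d+2}{d+2}\cdot 2\Big)^k\ (\le 4^k).$$ 2. There is an absolute constant $C>0$ (in particular independent of $n$, $k$, the codes, the observables and the state) such that the following holds. Let $O_1,\dots,O_M$ be logical Pauli observables, let $\epsilon,\delta>0$, and let $$N\ \ge\ C\,\frac{\log(\max\{M,2\})\,4^k}{\epsilon\,\delta^2}.$$ For every state $\rho$ on the $nk$ qubits, the sample means $\tilde O_i=\frac1N\sum_{s=1}^N\hat o_i^{(s)}$ of the single-shot values over $N$ independent samples satisfy $$\Pr\big(|\tilde O_i-\operatorname{Tr}(\Pi\rho\Pi O_i)|\ge\delta\big)\le\epsilon\qquad\text{for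 every } i\in\{1,\dots,M\}.$$ Moreover, the same number of samples suffices for all observables simultaneously: there is a function $f$, not depending on $\rho$, such that the estimates $\tilde O_i=f(\hat o_i^{(1)},\dots,\hat o_i^{(N)})$ satisfy, for every state $\rho$, $$\Pr\big(\exists\, i:\ |\tilde O_i-\operatorname{Tr}(\Pi\rho\Pi O_i)|\ge\delta\big)\le\epsilon .$$ -/

import Mathlib

open MeasureTheory
open scoped Matrix ENNReal ComplexOrder

namespace LST

/-! ### Qubits, Pauli group and Clifford group -/

/-- Computational basis labels (bit strings) of `n` qubits. -/
abbrev Bits (n : ℕ) : Type := Fin n → Fin 2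

/-- The tensor (Kronecker) product of a finite family of square matrices; the tensor product space
has the basis `ι → m`. -/
def tensor {ι m : Type*} [Fintype ι] (A : ι → Matrix m m ℂ) : Matrix (ι → m) (ι → m) ℂ :=
  Matrix.of fun x y => ∏ i, A i (x i) (y i)

theorem tensor_mul {ι m : Type*} [Fintype ι] [DecidableEq ι] [Fintype m]
    (A B : ι → Matrix m m ℂ) : tensor A * tensor B = tensor fun i => A i * B i := by
  ext x y
  simp only [tensor, Matrix.mul_apply, Matrix.of_apply, ← Finset.prod_mul_distrib]
  rw [Finset.prod_univ_sum, Fintype.piFinset_univ]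

theorem tensor_conjTranspose {ι m : Type*} [Fintype ι] (A : ι → Matrix m m ℂ) :
    (tensor A)ᴴ = tensor fun i => (A i)ᴴ := by
  ext x y
  simp [tensor, Matrix.conjTranspose_apply]

theorem tensor_one {ι m : Type*} [Fintype ι] [DecidableEq m] :
    tensor (fun _ : ι => (1 : Matrix m m ℂ)) = 1 := by
  ext x y
  simp only [tensor, Matrix.of_apply, Matrix.one_apply, funext_iff]
  by_cases h : ∀ i, x i = y i
  · simp [h]
  · obtain ⟨i, hi⟩ := not_forall.1 h
    rw [if_neg h]
    exact Finset.prod_eq_zero (Finset.mem_univ i) (if_neg hi)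

theorem tensor_smul {ι m : Type*} [Fintype ι] (c : ι → ℂ) (A : ι → Matrix m m ℂ) :
    (tensor fun i => c i • A i) = (∏ i, c i) • tensor A := by
  ext x y
  simp [tensor, Finset.prod_mul_distrib]

theorem tensor_mem_unitaryGroup {ι m : Type*} [Fintype ι] [DecidableEq ι] [Fintype m]
    [DecidableEq m] (A : ι → Matrix m m ℂ) (hA : ∀ i, A i ∈ Matrix.unitaryGroup m ℂ) :
    tensor A ∈ Matrix.unitaryGroup (ι → m) ℂ := by
  rw [Matrix.mem_unitaryGroup_iff, Matrix.star_eq_conjTranspose, tensor_conjTranspose, tensor_mul]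
  have h : (fun i => A i * (A i)ᴴ) = fun _ => 1 := by
    funext i
    have := Matrix.mem_unitaryGroup_iff.1 (hA i)
    rwa [Matrix.star_eq_conjTranspose] at this
  rw [h, tensor_one]

/-- The single-qubit Pauli matrices `1, X, Y, Z`. -/
def pauliMatrix : Fin 4 → Matrix (Fin 2) (Fin 2) ℂ :=
  ![1, !![0, 1; 1, 0], !![0, -Complex.I; Complex.I, 0], !![1, 0; 0, -1]]

/-- The `n`-qubit Pauli string `P₁ ⊗ ⋯ ⊗ Pₙ`. -/
def pauliString {n : ℕ} (p : Fin n → Fin 4) : Matrix (Bits n) (Bits n) ℂ :=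
  tensor fun j => pauliMatrix (p j)

theorem pauliMatrix_conjTranspose (a : Fin 4) : (pauliMatrix a)ᴴ = pauliMatrix a := by
  fin_cases a <;> ext i j <;> fin_cases i <;> fin_cases j <;>
    simp [pauliMatrix, Matrix.conjTranspose_apply]

theorem pauliMatrix_mul_self (a : Fin 4) : pauliMatrix a * pauliMatrix a = 1 := by
  fin_cases a <;> ext i j <;> fin_cases i <;> fin_cases j <;>
    simp [pauliMatrix, Matrix.mul_apply]

theorem pauliMatrix_mul (a b : Fin 4) :
    ∃ (c : Fin 4) (e : ℕ), pauliMatrix a * pauliMatrix b = Complex.I ^ e • pauliMatrix c := by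
  have h3 : Complex.I ^ 3 = -Complex.I := Complex.I_pow_three
  have h0 : pauliMatrix 0 = 1 := rfl
  fin_cases a <;> fin_cases b
  · exact ⟨0, 0, by simp [pauliMatrix]⟩
  · exact ⟨1, 0, by simp [pauliMatrix]⟩
  · exact ⟨2, 0, by simp [pauliMatrix]⟩
  · exact ⟨3, 0, by simp [pauliMatrix]⟩
  · exact ⟨1, 0, by simp [pauliMatrix]⟩
  · exact ⟨0, 0, by simpa [h0] using pauliMatrix_mul_self 1⟩
  · exact ⟨3, 1, by simp [pauliMatrix]⟩
  · exact ⟨2, 3, by simp [pauliMatrix, h3]⟩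
  · exact ⟨2, 0, by simp [pauliMatrix]⟩
  · exact ⟨3, 3, by simp [pauliMatrix, h3]⟩
  · exact ⟨0, 0, by simpa [h0] using pauliMatrix_mul_self 2⟩
  · exact ⟨1, 1, by simp [pauliMatrix]⟩
  · exact ⟨3, 0, by simp [pauliMatrix]⟩
  · exact ⟨2, 1, by simp [pauliMatrix]⟩
  · exact ⟨1, 3, by simp [pauliMatrix, h3]⟩
  · exact ⟨0, 0, by simpa [h0] using pauliMatrix_mul_self 3⟩

theorem pauliString_conjTranspose {n : ℕ} (p : Fin n → Fin 4) :
    (pauliString p)ᴴ = pauliString p := by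
  simp [pauliString, tensor_conjTranspose, pauliMatrix_conjTranspose]

theorem pauliString_mul {n : ℕ} (p q : Fin n → Fin 4) :
    ∃ (r : Fin n → Fin 4) (e : ℕ),
      pauliString p * pauliString q = Complex.I ^ e • pauliString r := by
  choose c e h using pauliMatrix_mul
  refine ⟨fun j => c (p j) (q j), ∑ j, e (p j) (q j), ?_⟩
  simp only [pauliString, tensor_mul, h]
  rw [tensor_smul, Finset.prod_pow_eq_pow_sum]

theorem pauliString_mem_unitaryGroup {n : ℕ} (p : Fin n → Fin 4) :
    pauliString p ∈ Matrix.unitaryGroup (Bits n) ℂ := by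
  refine tensor_mem_unitaryGroup _ fun j => ?_
  rw [Matrix.mem_unitaryGroup_iff, Matrix.star_eq_conjTranspose, pauliMatrix_conjTranspose,
    pauliMatrix_mul_self]

/-- A Pauli string as an element of the unitary group `U(2ⁿ)`. -/
def pauliUnitary {n : ℕ} (p : Fin n → Fin 4) : Matrix.unitaryGroup (Bits n) ℂ :=
  ⟨pauliString p, pauliString_mem_unitaryGroup p⟩

/-- The `n`-qubit Pauli group, generated by the Pauli strings. -/
def pauliGroup (n : ℕ) : Subgroup (Matrix.unitaryGroup (Bits n) ℂ) :=
  Subgroup.closure (Set.range pauliUnitary)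

/-- The group of all Clifford unitaries: the normalizer of the Pauli group in `U(2ⁿ)`. -/
def cliffordUnitaries (n : ℕ) : Subgroup (Matrix.unitaryGroup (Bits n) ℂ) :=
  Subgroup.normalizer (pauliGroup n : Set (Matrix.unitaryGroup (Bits n) ℂ))

/-- The global phases: scalar unitaries `z • 1`. -/
def globalPhases (n : ℕ) : Subgroup (Matrix.unitaryGroup (Bits n) ℂ) where
  carrier := {u | ∃ z : ℂ, (u : Matrix (Bits n) (Bits n) ℂ) = z • 1}
  mul_mem' := by
    rintro u v ⟨z, hz⟩ ⟨w, hw⟩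
    exact ⟨z * w, by simp [hz, hw, smul_smul, mul_comm]⟩
  one_mem' := ⟨1, by simp⟩
  inv_mem' := by
    rintro u ⟨z, hz⟩
    exact ⟨star z, by simp [Matrix.UnitaryGroup.inv_val, hz]⟩

/-- The Clifford group `Cℓ(2ⁿ)`: Clifford unitaries modulo global phase. -/
abbrev CliffordGroup (n : ℕ) : Type :=
  cliffordUnitaries n ⧸ (globalPhases n).subgroupOf (cliffordUnitaries n)

theorem mem_pauliGroup_form {n : ℕ} {u : Matrix.unitaryGroup (Bits n) ℂ}
    (hu : u ∈ pauliGroup n) :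
    ∃ (p : Fin n → Fin 4) (e : ℕ),
      (u : Matrix (Bits n) (Bits n) ℂ) = Complex.I ^ e • pauliString p := by
  induction hu using Subgroup.closure_induction with
  | mem x hx =>
    obtain ⟨p, rfl⟩ := hx
    exact ⟨p, 0, by simp [pauliUnitary]⟩
  | one =>
    refine ⟨fun _ => 0, 0, ?_⟩
    have h : pauliMatrix 0 = 1 := rfl
    simp [pauliString, h, tensor_one]
  | mul x y _ _ hx hy =>
    obtain ⟨p, e, hp⟩ := hx
    obtain ⟨q, f, hq⟩ := hy
    obtain ⟨r, g, hr⟩ := pauliString_mul p q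
    refine ⟨r, e + f + g, ?_⟩
    rw [Matrix.UnitaryGroup.mul_val, hp, hq, Matrix.smul_mul, Matrix.mul_smul, hr, smul_smul,
      smul_smul]
    congr 1
    ring
  | inv x _ hx =>
    obtain ⟨p, e, hp⟩ := hx
    refine ⟨p, 3 * e, ?_⟩
    rw [Matrix.UnitaryGroup.inv_val, hp, star_smul, Matrix.star_eq_conjTranspose,
      pauliString_conjTranspose]
    congr 1
    rw [pow_mul, Complex.I_pow_three]
    simp

instance pauliGroup_finite (n : ℕ) : Finite (pauliGroup n) := by
  have key : ∀ u : pauliGroup n, ∃ pe : (Fin n → Fin 4) × Fin 4,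
      (u.1 : Matrix (Bits n) (Bits n) ℂ) = Complex.I ^ (pe.2 : ℕ) • pauliString pe.1 := by
    intro u
    obtain ⟨p, e, h⟩ := mem_pauliGroup_form u.2
    refine ⟨(p, ⟨e % 4, Nat.mod_lt _ (by norm_num)⟩), ?_⟩
    rw [h]
    congr 1
    exact Complex.I_pow_eq_pow_mod e
  choose f hf using key
  refine Finite.of_injective f fun u v huv => ?_
  apply Subtype.ext
  apply Subtype.ext
  rw [hf u, hf v, huv]

/-- A matrix commuting with every Pauli string is a scalar. -/
theorem eq_smul_one_of_commute_pauliString {n : ℕ} (W : Matrix (Bits n) (Bits n) ℂ)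
    (hW : ∀ p : Fin n → Fin 4, W * pauliString p = pauliString p * W) :
    ∃ z : ℂ, W = z • 1 := by
  have hZ : ∀ (p : Fin n → Fin 4), (∀ j, p j = 0 ∨ p j = 3) →
      pauliString p = Matrix.diagonal fun x => ∏ j, pauliMatrix (p j) (x j) (x j) := by
    intro p hp
    ext x y
    simp only [pauliString, tensor, Matrix.of_apply]
    by_cases hxy : x = y
    · subst hxy; simp
    · rw [Matrix.diagonal_apply_ne _ hxy]
      obtain ⟨j, hj⟩ := Function.ne_iff.1 hxy
      refine Finset.prod_eq_zero (Finset.mem_univ j) ?_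
      generalize x j = a at hj ⊢
      generalize y j = b at hj ⊢
      rcases hp j with h | h <;> rw [h] <;> fin_cases a <;> fin_cases b <;>
        simp_all [pauliMatrix]
  have hoff : ∀ x y, x ≠ y → W x y = 0 := by
    intro x y hxy
    obtain ⟨j, hj⟩ := Function.ne_iff.1 hxy
    have h := hW (Pi.single j 3)
    rw [hZ _ (fun i => by
      by_cases hi : i = j
      · subst hi; simp
      · simp [Pi.single_eq_of_ne hi])] at h
    have h2 := congrFun (congrFun h x) y
    rw [Matrix.mul_diagonal, Matrix.diagonal_mul] at h2
    have hprod : ∀ z : Bits n, ∏ i, pauliMatrix ((Pi.single j 3 : Fin n → Fin 4) i) (z i) (z i)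
        = pauliMatrix 3 (z j) (z j) := by
      intro z
      rw [Finset.prod_eq_single j]
      · simp
      · intro i _ hi
        rw [Pi.single_eq_of_ne hi]
        simp [pauliMatrix]
      · simp
    rw [hprod, hprod] at h2
    generalize x j = a at hj h2
    generalize y j = b at hj h2
    fin_cases a <;> fin_cases b <;> simp [pauliMatrix] at hj h2
    · linear_combination (-1 / 2 : ℂ) * h2
    · linear_combination (1 / 2 : ℂ) * h2
  have hX : ∀ x y : Bits n, W x x = W y y := by
    intro x y
    let p : Fin n → Fin 4 := fun j => if x j = y j then 0 else 1
    have hp1 : pauliString p x y = 1 := by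
      simp only [pauliString, tensor, Matrix.of_apply]
      refine Finset.prod_eq_one fun j _ => ?_
      simp only [p]
      generalize x j = a
      generalize y j = b
      fin_cases a <;> fin_cases b <;> simp [pauliMatrix]
    have h := congrFun (congrFun (hW p) x) y
    rw [Matrix.mul_apply, Matrix.mul_apply, Finset.sum_eq_single x, Finset.sum_eq_single y, hp1]
      at h
    · simpa using h
    · intro z _ hz
      rw [hoff z y hz, mul_zero]
    · simp
    · intro z _ hz
      rw [hoff x z (Ne.symm hz), zero_mul]
    · simp
  refine ⟨W 0 0, ?_⟩
  ext x y
  by_cases hxy : x = y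
  · subst hxy
    simp [hX x 0]
  · simp [hoff x y hxy, Matrix.one_apply_ne hxy]

instance cliffordGroup_finite (n : ℕ) : Finite (CliffordGroup n) := by
  have hmem : ∀ (U : cliffordUnitaries n) (p : Fin n → Fin 4),
      U.1 * pauliUnitary p * U.1⁻¹ ∈ pauliGroup n := fun U p =>
    (Subgroup.mem_normalizer_iff.1 U.2 _).1 (Subgroup.subset_closure ⟨p, rfl⟩)
  let f : CliffordGroup n → (Fin n → Fin 4) → pauliGroup n :=
    fun q p => ⟨_, hmem (Quotient.out q) p⟩
  refine Finite.of_injective f fun q r hqr => ?_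
  rw [← QuotientGroup.out_eq' q, ← QuotientGroup.out_eq' r, QuotientGroup.eq,
    Subgroup.mem_subgroupOf]
  set U : cliffordUnitaries n := Quotient.out q with hU
  set V : cliffordUnitaries n := Quotient.out r with hV
  refine eq_smul_one_of_commute_pauliString _ fun p => ?_
  have h : U.1 * pauliUnitary p * U.1⁻¹ = V.1 * pauliUnitary p * V.1⁻¹ :=
    congrArg Subtype.val (congrFun hqr p)
  have h2 : (U.1⁻¹ * V.1) * pauliUnitary p = pauliUnitary p * (U.1⁻¹ * V.1) := by
    have h3 := congrArg (fun g => U.1⁻¹ * g * V.1) h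
    simp only [mul_assoc, inv_mul_cancel, mul_one, inv_mul_cancel_left] at h3
    rw [mul_assoc, ← h3]
  exact congrArg Subtype.val h2

noncomputable instance cliffordGroup_fintype (n : ℕ) : Fintype (CliffordGroup n) :=
  Fintype.ofFinite _

/-! ### Stabilizer codes and logical Pauli observables -/

/-- An `[[n, r]]` stabilizer code: an abelian subgroup of the Pauli group that does not contain
`-1` and has `n - r` independent generators, i.e. order `2 ^ (n - r)`. -/
structure StabilizerCode (n r : ℕ) where
  stabilizer : Subgroup (Matrix.unitaryGroup (Bits n) ℂ)
  le_pauliGroup : stabilizer ≤ pauliGroup n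
  comm : ∀ g ∈ stabilizer, ∀ h ∈ stabilizer, g * h = h * g
  neg_one_notMem : ∀ g ∈ stabilizer, (g : Matrix (Bits n) (Bits n) ℂ) ≠ -1
  card_mul : Nat.card stabilizer * 2 ^ r = 2 ^ n

instance StabilizerCode.finite_stabilizer {n r : ℕ} (S : StabilizerCode n r) :
    Finite S.stabilizer :=
  Finite.of_injective _ (Subgroup.inclusion_injective S.le_pauliGroup)

noncomputable instance StabilizerCode.fintype_stabilizer {n r : ℕ} (S : StabilizerCode n r) :
    Fintype S.stabilizer :=
  Fintype.ofFinite _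

/-- The projector onto the code subspace, the average of all stabilizer elements. -/
noncomputable def StabilizerCode.projector {n r : ℕ} (S : StabilizerCode n r) :
    Matrix (Bits n) (Bits n) ℂ :=
  (Fintype.card S.stabilizer : ℂ)⁻¹ • ∑ g : S.stabilizer, (g.1 : Matrix (Bits n) (Bits n) ℂ)

/-- Operators on `k` blocks of `n` physical qubits. -/
abbrev Op (n k : ℕ) : Type := Matrix (Fin k → Bits n) (Fin k → Bits n) ℂ

/-- The projector `Π = P₁ ⊗ ⋯ ⊗ Pₖ` onto the code subspace when the `i`-th logical qubit is encoded
in the `i`-th block by the code `S i`. -/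
noncomputable def codeProjector {n k : ℕ} (S : Fin k → StabilizerCode n 1) : Op n k :=
  tensor fun i => (S i).projector

/-- Logical Pauli observables: signed Pauli strings on all `n * k` physical qubits that commute
with the code projector. -/
def IsLogicalPauli {n k : ℕ} (S : Fin k → StabilizerCode n 1) (O : Op n k) : Prop :=
  (∃ p : Fin k → Fin n → Fin 4,
    O = (tensor fun i => pauliString (p i)) ∨ O = -(tensor fun i => pauliString (p i))) ∧
  Commute (codeProjector S) O

/-! ### Randomized measurements -/

/-- Density matrices. -/
structure DensityMatrix (m : Type*) [Fintype m] where
  mat : Matrix m m ℂ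
  posSemidef : mat.PosSemidef
  trace_eq_one : mat.trace = 1

/-- The state `U ρ U†`. -/
def DensityMatrix.conj {m : Type*} [Fintype m] [DecidableEq m] (ρ : DensityMatrix m)
    (U : Matrix.unitaryGroup m ℂ) : DensityMatrix m where
  mat := U.1 * ρ.mat * U.1ᴴ
  posSemidef := ρ.posSemidef.mul_mul_conjTranspose_same U.1
  trace_eq_one := by
    have h : U.1ᴴ * U.1 = 1 := Matrix.mem_unitaryGroup_iff'.1 U.2
    rw [Matrix.trace_mul_comm, ← mul_assoc, h, one_mul, ρ.trace_eq_one]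

/-- The law of the outcome of measuring `ρ` in the computational basis: `b` has probability
`⟨b|ρ|b⟩`. -/
noncomputable def DensityMatrix.measure {m : Type*} [Fintype m] (ρ : DensityMatrix m) : PMF m :=
  PMF.ofFintype (fun b => ENNReal.ofReal (ρ.mat b b).re) (by
    rw [← ENNReal.ofReal_sum_of_nonneg
      (fun b _ => (Complex.le_def.1 ρ.posSemidef.diag_nonneg).1)]
    have h := congrArg Complex.re ρ.trace_eq_one
    rw [Matrix.trace, Complex.re_sum] at h
    simp only [Matrix.diag_apply] at h
    rw [h]
    simp)

/-- The Clifford circuits used: elements of `Cℓ(2ⁿ)^{⊗k}`, one Clifford per block. -/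
abbrev Circuit (n k : ℕ) : Type := Fin k → CliffordGroup n

/-- The unitary `U₁ ⊗ ⋯ ⊗ Uₖ` of a circuit. A representative of each class is chosen; the global
phase has no effect on measurements. -/
noncomputable def Circuit.unitary {n k : ℕ} (u : Circuit n k) :
    Matrix.unitaryGroup (Fin k → Bits n) ℂ :=
  ⟨tensor fun i => ((Quotient.out (u i) : cliffordUnitaries n).1 : Matrix (Bits n) (Bits n) ℂ),
    tensor_mem_unitaryGroup _ fun i => (Quotient.out (u i) : cliffordUnitaries n).1.2⟩

/-- The data `(U, b)` recorded in one round: the circuit and the measured bit string. -/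
abbrev Shot (n k : ℕ) : Type := Circuit n k × (Fin k → Bits n)

instance cliffordGroup_measurableSpace (n : ℕ) : MeasurableSpace (CliffordGroup n) := ⊤

/-- The law of one round: `U` is uniform in `Cℓ(2ⁿ)^{⊗k}`, then `U ρ U†` is measured. -/
noncomputable def shotLaw {n k : ℕ} (ρ : DensityMatrix (Fin k → Bits n)) : PMF (Shot n k) :=
  (PMF.uniformOfFintype (Circuit n k)).bind fun u =>
    (ρ.conj u.unitary).measure.map fun b => (u, b)

/-- The law of the data of `N` independent rounds. -/
noncomputable def samplesLaw {n k : ℕ} (ρ : DensityMatrix (Fin k → Bits n)) (N : ℕ) :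
    Measure (Fin N → Shot n k) :=
  Measure.pi fun _ => (shotLaw ρ).toMeasure

/-! ### Classical shadows -/

/-- The snapshot `U† |b⟩⟨b| U`. -/
noncomputable def snapshot {n k : ℕ} (s : Shot n k) : Op n k :=
  (s.1.unitary.1)ᴴ * Matrix.single s.2 s.2 1 * s.1.unitary.1

/-- The measurement channel `A ↦ 𝔼_U ∑_b ⟨b|U A U†|b⟩ U†|b⟩⟨b|U`. -/
noncomputable def shadowChannel (n k : ℕ) : Module.End ℂ (Op n k) where
  toFun A := (Fintype.card (Circuit n k) : ℂ)⁻¹ •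
    ∑ u : Circuit n k, ∑ b : Fin k → Bits n,
      ((u.unitary.1 * A * (u.unitary.1)ᴴ) b b) • snapshot (u, b)
  map_add' A B := by
    simp only [mul_add, add_mul, Matrix.add_apply, add_smul, Finset.sum_add_distrib, smul_add]
  map_smul' c A := by
    simp only [Matrix.mul_smul, Matrix.smul_mul, Matrix.smul_apply, smul_eq_mul, mul_smul,
      ← Finset.smul_sum, RingHom.id_apply]
    rw [smul_comm]

/-- The reconstruction map, the inverse of the measurement channel. -/
noncomputable def reconstruction (n k : ℕ) : Module.End ℂ (Op n k) :=
  Ring.inverse (shadowChannel n k)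

/-- The value `Tr(Π ρ̂ Π O)` for the classical shadow `ρ̂` of one round. -/
noncomputable def singleShotEstimate {n k : ℕ} (S : Fin k → StabilizerCode n 1) (O : Op n k)
    (s : Shot n k) : ℂ :=
  (codeProjector S * reconstruction n k (snapshot s) * codeProjector S * O).trace

/-- The sample mean of `Tr(Π ρ̂ Π O)` over the `N` classical shadows. -/
noncomputable def sampleMeanEstimate {n k N : ℕ} (S : Fin k → StabilizerCode n 1) (O : Op n k)
    (ω : Fin N → Shot n k) : ℂ :=
  (N : ℂ)⁻¹ * ∑ s, singleShotEstimate S O (ω s)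

/-- `𝔼_U ∑_b ⟨b|U σ U†|b⟩ |⟨b|U M⁻¹(A) U†|b⟩|²`. -/
noncomputable def shadowSecondMoment {n k : ℕ} (σ : DensityMatrix (Fin k → Bits n))
    (A : Op n k) : ℝ :=
  (Fintype.card (Circuit n k) : ℝ)⁻¹ *
    ∑ u : Circuit n k, ∑ b : Fin k → Bits n,
      ((σ.conj u.unitary).mat b b).re *
        ‖(u.unitary.1 * reconstruction n k A * (u.unitary.1)ᴴ) b b‖ ^ 2

/-- The shadow norm of `A`, a maximum over all states. -/
noncomputable def shadowNorm {n k : ℕ} (A : Op n k) : ℝ :=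
  ⨆ σ : DensityMatrix (Fin k → Bits n), √(shadowSecondMoment σ A)

end LST

/-! Pauli strings diagonalize the problem. Up to phase they are labelled by vectors of the
symplectic space `Phase n`, the form deciding commutation. A Clifford unitary permutes them up to
phase, and a Pauli string is either diagonal or has zero diagonal. Measuring after `U` therefore
keeps exactly the strings that `U` makes diagonal, so the channel multiplies a string by the
probability `f(a, a)` that a random Clifford makes it diagonal (one factor per block). These
probabilities are positive, so the channel is invertible.

Second moments need only the joint probabilities `f(a, c)` of making two strings diagonal. The
uniform law on the Clifford group is invariant under right multiplication by transvections `(1 + iW)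
/ √2`, and these act transitively enough to make `f` constant on the relevant classes of pairs. Each
Clifford makes exactly `d = 2 ^ n` strings diagonal, and they commute, so counting gives `f(a, a) =
1 / (d + 1)` and `f(a, c) = 2 / ((d + 1) (d + 2))` for distinct commuting nontrivial strings
(`diagProb_self`, `diagProb_of_ne`). No classification of the Clifford group is needed.

The operator `ΠO` is an average, with phases, of Pauli strings whose labels in each block are
distinct and `d / 2` in number. Its second moment is a double sum over pairs of strings, with
weights `f(a, c) / (f(a, a) f(c, c))` times an expectation of modulus at most one in the state. The
sum of the moduli factors over the blocks, and each factor is at most `4 (d + 1) / (d + 2) ≤ 4`.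

For the statistics, the channel is self-adjoint for the trace pairing, so the single-shot value is
an unbiased estimator whose second moment is the one in the shadow norm, hence at most `4 ^ k`.
Chebyshev's inequality handles each sample mean. For all observables at once, the samples are split
into about `log (M / ε)` groups; a point close to most group means plays the role of a median of
means, fails with exponentially small probability, and a union bound over the observables concludes.
-/

namespace LST

/-! ### Pauli strings indexed by a symplectic space -/

/-- The phase space of `n` qubits: the vector `(x, z)` labels the Pauli string `XˣZᶻ`, up to a
phase. -/
abbrev Phase (n : ℕ) : Type := Fin n → ZMod 2 × ZMod 2

/-- The index of a single-qubit Pauli matrix in terms of its `X` and `Z` components. -/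
def pauliIndex (v : ZMod 2 × ZMod 2) : Fin 4 :=
  if v = (0, 0) then 0 else if v = (1, 0) then 1 else if v = (1, 1) then 2 else 3

theorem pauliIndex_surjective : Function.Surjective pauliIndex := by
  unfold Function.Surjective
  decide

/-- The sign character of `ZMod 2`. -/
noncomputable def sgn (a : ZMod 2) : ℂ := if a = 0 then 1 else -1

theorem sgn_add (a b : ZMod 2) : sgn (a + b) = sgn a * sgn b := by
  have h : ∀ c : ZMod 2, c = 0 ∨ c = 1 := by decide
  have h2 : (1 : ZMod 2) + 1 = 0 := by decide
  rcases h a with rfl | rfl <;> rcases h b with rfl | rfl <;> simp [sgn, h2]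

theorem sgn_sum {ι : Type*} (s : Finset ι) (f : ι → ZMod 2) :
    sgn (∑ j ∈ s, f j) = ∏ j ∈ s, sgn (f j) := by
  classical
  induction s using Finset.induction_on with
  | empty => simp [sgn]
  | insert j s hj ih => rw [Finset.sum_insert hj, Finset.prod_insert hj, sgn_add, ih]

/-- The symplectic form, which decides whether two Pauli strings commute. -/
def sympl {n : ℕ} (v w : Phase n) : ZMod 2 := ∑ j, ((v j).1 * (w j).2 + (v j).2 * (w j).1)

theorem sympl_comm {n : ℕ} (v w : Phase n) : sympl v w = sympl w v :=
  Finset.sum_congr rfl fun j _ => by ring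

theorem sympl_add_right {n : ℕ} (u v w : Phase n) :
    sympl u (v + w) = sympl u v + sympl u w := by
  rw [sympl, sympl, sympl, ← Finset.sum_add_distrib]
  exact Finset.sum_congr rfl fun j _ => by simp only [Pi.add_apply, Prod.fst_add, Prod.snd_add]; ring

theorem sympl_add_left {n : ℕ} (u v w : Phase n) :
    sympl (u + v) w = sympl u w + sympl v w := by
  rw [sympl_comm, sympl_add_right, sympl_comm w u, sympl_comm w v]

theorem zmod_two_cases (a : ZMod 2) : a = 0 ∨ a = 1 := by
  revert a; decide

theorem Phase.add_self {n : ℕ} (v : Phase n) : v + v = 0 := by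
  funext j
  exact Prod.ext (CharTwo.add_self_eq_zero _) (CharTwo.add_self_eq_zero _)

theorem Phase.add_eq_zero_iff {n : ℕ} {v w : Phase n} : v + w = 0 ↔ v = w := by
  constructor
  · intro h
    calc v = v + (w + w) := by rw [Phase.add_self, add_zero]
      _ = w := by rw [← add_assoc, h, zero_add]
  · rintro rfl
    exact Phase.add_self v

theorem sympl_self {n : ℕ} (v : Phase n) : sympl v v = 0 :=
  Finset.sum_eq_zero fun j _ => by rw [mul_comm]; exact CharTwo.add_self_eq_zero _

theorem sympl_zero_left {n : ℕ} (v : Phase n) : sympl 0 v = 0 := by simp [sympl]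

theorem exists_sympl_eq_one {n : ℕ} {v : Phase n} (hv : v ≠ 0) : ∃ w, sympl v w = 1 := by
  obtain ⟨j, hj⟩ := Function.ne_iff.1 hv
  have key : ∀ a : ZMod 2 × ZMod 2, a ≠ 0 → ∃ b : ZMod 2 × ZMod 2, a.1 * b.2 + a.2 * b.1 = 1 := by
    decide
  obtain ⟨b, hb⟩ := key (v j) hj
  refine ⟨Pi.single j b, ?_⟩
  rw [sympl, Finset.sum_eq_single j]
  · simpa using hb
  · intro i _ hi
    simp [Pi.single_eq_of_ne hi]
  · simp

/-- Otherwise the functional of `v` vanishes on the kernel of that of `u`, so over the field with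
two elements it is `0` or that of `u`. Nondegeneracy then gives `v = 0` or `v = u`. -/
theorem exists_sympl_eq_zero_one {n : ℕ} {u v : Phase n} (hv : v ≠ 0) (huv : v ≠ u) :
    ∃ w, sympl u w = 0 ∧ sympl v w = 1 := by
  by_contra! hcon
  have h0 : ∀ w, sympl u w = 0 → sympl v w = 0 := fun w hw =>
    (zmod_two_cases _).resolve_right (hcon w hw)
  obtain ⟨a, ha⟩ := exists_sympl_eq_one hv
  have hua : sympl u a = 1 := by
    refine (zmod_two_cases _).resolve_left fun h => ?_
    rw [h0 a h] at ha
    exact absurd ha (by decide)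
  have hne : v + u ≠ 0 := fun h => huv (Phase.add_eq_zero_iff.1 h)
  obtain ⟨b, hb⟩ := exists_sympl_eq_one hne
  rw [sympl_add_left] at hb
  rcases zmod_two_cases (sympl u b) with h | h
  · rw [h0 b h, h] at hb
    exact absurd hb (by decide)
  · have h1 := h0 (a + b) (by rw [sympl_add_right, hua, h]; decide)
    rw [sympl_add_right, ha] at h1
    have h2 : sympl v b = 1 := by
      refine (zmod_two_cases _).resolve_left fun h' => ?_
      rw [h'] at h1
      exact absurd h1 (by decide)
    rw [h2, h] at hb
    exact absurd hb (by decide)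

/-- If two vectors each have a partner in the complement of `u`, they have a common one. -/
theorem exists_sympl_common {n : ℕ} {u v v' : Phase n}
    (hv : ∃ w, sympl u w = 0 ∧ sympl v w = 1) (hv' : ∃ w, sympl u w = 0 ∧ sympl v' w = 1) :
    ∃ w, sympl u w = 0 ∧ sympl v w = 1 ∧ sympl v' w = 1 := by
  obtain ⟨a, hua, hva⟩ := hv
  obtain ⟨b, hub, hvb⟩ := hv'
  rcases zmod_two_cases (sympl v' a) with h | h
  · rcases zmod_two_cases (sympl v b) with h' | h'
    · exact ⟨a + b, by rw [sympl_add_right, hua, hub, add_zero],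
        by rw [sympl_add_right, hva, h', add_zero], by rw [sympl_add_right, h, hvb, zero_add]⟩
    · exact ⟨b, hub, h', hvb⟩
  · exact ⟨a, hua, hva, h⟩

/-- The symplectic transvection `v ↦ v + ω(v, c) c`. -/
def transvection {n : ℕ} (c v : Phase n) : Phase n := if sympl v c = 0 then v else v + c

/-- A property invariant under the transvections along the complement of `u` cannot separate two
vectors with the same pairing with `u`, neither of which is `0` or `u`. -/
theorem transvection_invariant {n : ℕ} {α : Type*} {u : Phase n} (F : Phase n → α)
    (hF : ∀ c v, sympl u c = 0 → F (transvection c v) = F v) {v v' : Phase n}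
    (hv : v ≠ 0) (huv : v ≠ u) (hv' : v' ≠ 0) (huv' : v' ≠ u) (h : sympl u v = sympl u v') :
    F v = F v' := by
  -- When `v` and `v'` pair to one, the transvection along `v + v'` sends `v` to `v'`, and equal
  -- pairings with `u` put `v + v'` in the complement of `u`.
  have step : ∀ v v', sympl u v = sympl u v' → sympl v v' = 1 → F v = F v' := by
    intro v v' h h1
    have h2 : sympl v (v + v') = 1 := by rw [sympl_add_right, sympl_self, h1, zero_add]
    have h3 := hF (v + v') v (by rw [sympl_add_right, h]; exact CharTwo.add_self_eq_zero _)
    rw [transvection, if_neg (by rw [h2]; decide), ← add_assoc, Phase.add_self, zero_add] at h3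
    exact h3.symm
  obtain ⟨w, hw, hvw, hvw'⟩ := exists_sympl_common (exists_sympl_eq_zero_one hv huv)
    (exists_sympl_eq_zero_one hv' huv')
  rw [← hF w v hw, ← hF w v' hw]
  rw [transvection, transvection, if_neg (by rw [hvw]; decide), if_neg (by rw [hvw']; decide)]
  -- If `v` and `v'` are orthogonal, the detour through `v + w` works, as it pairs to one with `v'`.
  rcases zmod_two_cases (sympl v v') with h0 | h0
  · have e1 : F (v + w) = F v := by
      have := hF w v hw
      rwa [transvection, if_neg (by rw [hvw]; decide)] at this
    have e2 : F (v' + w) = F v' := by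
      have := hF w v' hw
      rwa [transvection, if_neg (by rw [hvw']; decide)] at this
    have e3 : F (v + w) = F v' := by
      refine step _ _ (by rw [sympl_add_right, hw, h, add_zero]) ?_
      rw [sympl_add_left, h0, sympl_comm, hvw', zero_add]
    rw [e3, e2]
  · have e1 : F (v + w) = F v := by
      have := hF w v hw
      rwa [transvection, if_neg (by rw [hvw]; decide)] at this
    have e2 : F (v' + w) = F v' := by
      have := hF w v' hw
      rwa [transvection, if_neg (by rw [hvw']; decide)] at this
    rw [e1, e2, step v v' h h0]

/-- Translation by a partner of `a` permutes the labels and flips every sign. -/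
theorem sum_sgn_sympl {n : ℕ} {a : Phase n} (ha : a ≠ 0) : ∑ b, sgn (sympl a b) = 0 := by
  obtain ⟨w, hw⟩ := exists_sympl_eq_one ha
  have h : ∑ b, sgn (sympl a b) = ∑ b, sgn (sympl a (b + w)) :=
    (Equiv.sum_comp (Equiv.addRight w) fun b => sgn (sympl a b)).symm
  have h1 : sgn 1 = -1 := by simp [sgn]
  simp only [sympl_add_right, sgn_add, hw, h1, ← Finset.sum_mul] at h
  linear_combination h / 2

theorem card_phase (n : ℕ) : Fintype.card (Phase n) = 4 ^ n := by
  simp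

theorem card_sympl_eq_zero {n : ℕ} {a : Phase n} (ha : a ≠ 0) :
    2 * (Finset.univ.filter fun b => sympl a b = 0).card = 4 ^ n := by
  have h := sum_sgn_sympl ha
  have h1 : ∀ b, sgn (sympl a b) = 2 * (if sympl a b = 0 then 1 else 0) - 1 := by
    intro b
    rw [sgn]
    split_ifs <;> norm_num
  simp only [h1, Finset.sum_sub_distrib, ← Finset.mul_sum, Finset.sum_boole, Finset.sum_const,
    Finset.card_univ, card_phase] at h
  have h2 : (2 * (Finset.univ.filter fun b => sympl a b = 0).card : ℂ) = (4 ^ n : ℕ) := by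
    rw [sub_eq_zero] at h
    rw [h]; simp
  exact_mod_cast h2

/-! ### Pauli strings -/

/-- The Pauli string labelled by a vector of the phase space. -/
def weyl {n : ℕ} (v : Phase n) : Matrix (Bits n) (Bits n) ℂ :=
  pauliString fun j => pauliIndex (v j)

/-- `weyl v` as an element of the unitary group. -/
def weylUnitary {n : ℕ} (v : Phase n) : Matrix.unitaryGroup (Bits n) ℂ :=
  pauliUnitary fun j => pauliIndex (v j)

theorem exists_weyl_eq {n : ℕ} (p : Fin n → Fin 4) :
    ∃ v : Phase n, p = fun j => pauliIndex (v j) := by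
  choose f hf using pauliIndex_surjective
  exact ⟨fun j => f (p j), funext fun j => (hf _).symm⟩

theorem weyl_zero {n : ℕ} : weyl (0 : Phase n) = 1 := by
  have h : pauliMatrix (pauliIndex 0) = 1 := rfl
  simp [weyl, pauliString, h, tensor_one]

theorem weyl_conjTranspose {n : ℕ} (v : Phase n) : (weyl v)ᴴ = weyl v :=
  pauliString_conjTranspose _

theorem weyl_mul_self {n : ℕ} (v : Phase n) : weyl v * weyl v = 1 := by
  simp [weyl, pauliString, tensor_mul, pauliMatrix_mul_self, tensor_one]

theorem pauliMatrix_pauliIndex_mul (a b : ZMod 2 × ZMod 2) :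
    ∃ e : ℕ, pauliMatrix (pauliIndex a) * pauliMatrix (pauliIndex b) =
      Complex.I ^ e • pauliMatrix (pauliIndex (a + b)) := by
  have h3 : Complex.I ^ 3 = -Complex.I := Complex.I_pow_three
  have h0 : pauliMatrix 0 = 1 := rfl
  have hI : ∀ v : ZMod 2 × ZMod 2, v = (0, 0) ∨ v = (1, 0) ∨ v = (1, 1) ∨ v = (0, 1) := by decide
  have i0 : pauliIndex (0, 0) = 0 := by decide
  have i1 : pauliIndex (1, 0) = 1 := by decide
  have i2 : pauliIndex (1, 1) = 2 := by decide
  have i3 : pauliIndex (0, 1) = 3 := by decide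
  have h11 : (1 : ZMod 2) + 1 = 0 := by decide
  rcases hI a with rfl | rfl | rfl | rfl <;> rcases hI b with rfl | rfl | rfl | rfl <;>
    simp only [Prod.mk_add_mk, zero_add, add_zero, h11, i0, i1, i2, i3]
  · exact ⟨0, by simp [pauliMatrix]⟩
  · exact ⟨0, by simp [pauliMatrix]⟩
  · exact ⟨0, by simp [pauliMatrix]⟩
  · exact ⟨0, by simp [pauliMatrix]⟩
  · exact ⟨0, by simp [pauliMatrix]⟩
  · exact ⟨0, by simpa [h0] using pauliMatrix_mul_self 1⟩
  · exact ⟨1, by simp [pauliMatrix]⟩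
  · exact ⟨3, by simp [pauliMatrix, h3]⟩
  · exact ⟨0, by simp [pauliMatrix]⟩
  · exact ⟨3, by simp [pauliMatrix, h3]⟩
  · exact ⟨0, by simpa [h0] using pauliMatrix_mul_self 2⟩
  · exact ⟨1, by simp [pauliMatrix]⟩
  · exact ⟨0, by simp [pauliMatrix]⟩
  · exact ⟨1, by simp [pauliMatrix]⟩
  · exact ⟨3, by simp [pauliMatrix, h3]⟩
  · exact ⟨0, by simpa [h0] using pauliMatrix_mul_self 3⟩

theorem pauliMatrix_pauliIndex_comm (a b : ZMod 2 × ZMod 2) :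
    pauliMatrix (pauliIndex a) * pauliMatrix (pauliIndex b) =
      sgn (a.1 * b.2 + a.2 * b.1) • (pauliMatrix (pauliIndex b) * pauliMatrix (pauliIndex a)) := by
  have hI : ∀ v : ZMod 2 × ZMod 2, v = (0, 0) ∨ v = (1, 0) ∨ v = (1, 1) ∨ v = (0, 1) := by decide
  have i0 : pauliIndex (0, 0) = 0 := by decide
  have i1 : pauliIndex (1, 0) = 1 := by decide
  have i2 : pauliIndex (1, 1) = 2 := by decide
  have i3 : pauliIndex (0, 1) = 3 := by decide
  have h11 : (1 : ZMod 2) + 1 = 0 := by decide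
  rcases hI a with rfl | rfl | rfl | rfl <;> rcases hI b with rfl | rfl | rfl | rfl <;>
    simp [i0, i1, i2, i3, pauliMatrix, sgn, h11]

theorem weyl_mul {n : ℕ} (v w : Phase n) :
    ∃ e : ℕ, weyl v * weyl w = Complex.I ^ e • weyl (v + w) := by
  choose e h using pauliMatrix_pauliIndex_mul
  refine ⟨∑ j, e (v j) (w j), ?_⟩
  simp only [weyl, pauliString, tensor_mul, h]
  rw [tensor_smul, Finset.prod_pow_eq_pow_sum]
  rfl

theorem weyl_comm {n : ℕ} (v w : Phase n) :
    weyl v * weyl w = sgn (sympl v w) • (weyl w * weyl v) := by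
  simp only [weyl, pauliString, tensor_mul]
  rw [sympl, sgn_sum, ← tensor_smul]
  congr 1
  funext j
  exact pauliMatrix_pauliIndex_comm _ _

theorem trace_weyl {n : ℕ} {v : Phase n} (hv : v ≠ 0) : (weyl v).trace = 0 := by
  obtain ⟨w, hw⟩ := exists_sympl_eq_one hv
  have h : weyl w * (weyl v * weyl w) = -weyl v := by
    rw [weyl_comm v w, hw, Matrix.mul_smul, ← mul_assoc, weyl_mul_self, one_mul]
    simp [sgn]
  have h2 := congrArg Matrix.trace h
  rw [Matrix.trace_mul_comm, mul_assoc, weyl_mul_self, mul_one, Matrix.trace_neg] at h2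
  linear_combination h2 / 2

theorem trace_weyl_mul {n : ℕ} (v w : Phase n) :
    (weyl v * weyl w).trace = if v = w then 2 ^ n else 0 := by
  split_ifs with h
  · subst h
    rw [weyl_mul_self]
    simp
  · obtain ⟨e, he⟩ := weyl_mul v w
    rw [he, Matrix.trace_smul, trace_weyl fun h' => h (Phase.add_eq_zero_iff.1 h'), smul_zero]

theorem eq_of_weyl_eq_smul {n : ℕ} {v w : Phase n} {z : ℂ} (h : weyl v = z • weyl w) :
    v = w := by
  by_contra hne
  have h1 := congrArg (fun A => (weyl v * A).trace) h
  simp only [Matrix.mul_smul, Matrix.trace_smul, trace_weyl_mul, if_neg hne, if_true,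
    smul_zero] at h1
  exact pow_ne_zero n two_ne_zero h1

theorem weylUnitary_mem {n : ℕ} (v : Phase n) : weylUnitary v ∈ pauliGroup n :=
  Subgroup.subset_closure ⟨_, rfl⟩

theorem mem_pauliGroup_weyl {n : ℕ} {u : Matrix.unitaryGroup (Bits n) ℂ}
    (hu : u ∈ pauliGroup n) : ∃ (v : Phase n) (e : ℕ),
      (u : Matrix (Bits n) (Bits n) ℂ) = Complex.I ^ e • weyl v := by
  obtain ⟨p, e, h⟩ := mem_pauliGroup_form hu
  obtain ⟨v, rfl⟩ := exists_weyl_eq p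
  exact ⟨v, e, h⟩

/-! ### Transvections as Clifford unitaries -/

/-- The Clifford unitary `(1 + i W) / √2` for a Pauli string `W`. -/
noncomputable def transvectionMatrix {n : ℕ} (c : Phase n) : Matrix (Bits n) (Bits n) ℂ :=
  (√2 : ℂ)⁻¹ • (1 + Complex.I • weyl c)

theorem transvectionMatrix_conjTranspose {n : ℕ} (c : Phase n) :
    (transvectionMatrix c)ᴴ = (√2 : ℂ)⁻¹ • (1 - Complex.I • weyl c) := by
  rw [transvectionMatrix, Matrix.conjTranspose_smul, Matrix.conjTranspose_add,
    Matrix.conjTranspose_smul, weyl_conjTranspose]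
  simp [sub_eq_add_neg]

theorem inv_sqrt_two_mul_self : (√2 : ℂ)⁻¹ * (√2 : ℂ)⁻¹ = 1 / 2 := by
  rw [← mul_inv, ← Complex.ofReal_mul, Real.mul_self_sqrt (by norm_num)]
  norm_num

theorem transvectionMatrix_mem {n : ℕ} (c : Phase n) :
    transvectionMatrix c ∈ Matrix.unitaryGroup (Bits n) ℂ := by
  rw [Matrix.mem_unitaryGroup_iff, Matrix.star_eq_conjTranspose,
    transvectionMatrix_conjTranspose, transvectionMatrix, Matrix.smul_mul, Matrix.mul_smul,
    smul_smul, inv_sqrt_two_mul_self]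
  have h : (1 + Complex.I • weyl c) * (1 - Complex.I • weyl c) = (2 : ℂ) • 1 := by
    have h5 : (Complex.I • weyl c) * (Complex.I • weyl c) = -1 := by
      rw [Matrix.smul_mul, Matrix.mul_smul, weyl_mul_self, smul_smul, Complex.I_mul_I]
      simp
    rw [add_mul, mul_sub, mul_sub, h5, one_mul, one_mul, mul_one, two_smul]
    abel
  rw [h, smul_smul]
  norm_num

/-- In the anticommuting case the cross terms add up: `(1 + iW_c) W_v (1 - iW_c) = 2i W_c W_v`. On
labels, conjugation is thus the symplectic transvection along `c`. -/
theorem transvectionMatrix_conj {n : ℕ} (c v : Phase n) :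
    transvectionMatrix c * weyl v * (transvectionMatrix c)ᴴ =
      if sympl v c = 0 then weyl v else Complex.I • (weyl c * weyl v) := by
  have h2 := Matrix.mem_unitaryGroup_iff.1 (transvectionMatrix_mem c)
  rw [Matrix.star_eq_conjTranspose] at h2
  split_ifs with h
  · have h1 : weyl c * weyl v = weyl v * weyl c := by
      rw [weyl_comm, sympl_comm, h]; simp [sgn]
    have h3 : transvectionMatrix c * weyl v = weyl v * transvectionMatrix c := by
      simp [transvectionMatrix, add_mul, mul_add, h1]
    rw [h3, mul_assoc, h2, mul_one]
  · have h1 : weyl v * weyl c = - (weyl c * weyl v) := by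
      rw [weyl_comm]; simp [sgn, h]
    rw [transvectionMatrix_conjTranspose, transvectionMatrix, Matrix.smul_mul, Matrix.smul_mul,
      Matrix.mul_smul, smul_smul, inv_sqrt_two_mul_self]
    have h4 : (1 + Complex.I • weyl c) * weyl v * (1 - Complex.I • weyl c) =
        (2 : ℂ) • Complex.I • (weyl c * weyl v) := by
      have h5 : weyl c * weyl v * weyl c = - weyl v := by
        rw [mul_assoc, h1, mul_neg, ← mul_assoc, weyl_mul_self, one_mul]
      rw [add_mul, mul_sub, one_mul, mul_one, Matrix.smul_mul, add_mul, Matrix.smul_mul,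
        Matrix.mul_smul, Matrix.mul_smul, h5, h1, two_smul, smul_neg, smul_neg, smul_neg,
        smul_smul, Complex.I_mul_I, neg_smul, one_smul]
      abel
    rw [h4, smul_smul]
    norm_num

theorem transvectionMatrix_conj_eq {n : ℕ} (c v : Phase n) : ∃ z : ℂ,
    transvectionMatrix c * weyl v * (transvectionMatrix c)ᴴ = z • weyl (transvection c v) := by
  rw [transvectionMatrix_conj, transvection]
  split_ifs with h
  · exact ⟨1, (one_smul _ _).symm⟩
  · obtain ⟨e, he⟩ := weyl_mul c v
    exact ⟨Complex.I * Complex.I ^ e, by rw [he, smul_smul, add_comm]⟩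

/-- `transvectionMatrix c` as an element of the unitary group. -/
noncomputable def transvectionUnitary {n : ℕ} (c : Phase n) : Matrix.unitaryGroup (Bits n) ℂ :=
  ⟨transvectionMatrix c, transvectionMatrix_mem c⟩

theorem transvectionUnitary_mem {n : ℕ} (c : Phase n) :
    transvectionUnitary c ∈ cliffordUnitaries n := by
  have hfin : Finite (pauliGroup n : Set (Matrix.unitaryGroup (Bits n) ℂ)) := pauliGroup_finite n
  -- For a finite subgroup, being mapped into itself by conjugation suffices for normalizing it, so
  -- only generators need checking.
  refine Subgroup.mem_normalizer_fintype fun g hg => ?_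
  have hle : pauliGroup n ≤
      (pauliGroup n).comap (MulAut.conj (transvectionUnitary c)).toMonoidHom := by
    refine (Subgroup.closure_le _).2 ?_
    rintro _ ⟨p, rfl⟩
    obtain ⟨v, rfl⟩ := exists_weyl_eq p
    change transvectionUnitary c * weylUnitary v * (transvectionUnitary c)⁻¹ ∈ pauliGroup n
    have hval : ((transvectionUnitary c * weylUnitary v * (transvectionUnitary c)⁻¹ :
        Matrix.unitaryGroup (Bits n) ℂ) : Matrix (Bits n) (Bits n) ℂ) =
        transvectionMatrix c * weyl v * (transvectionMatrix c)ᴴ := rfl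
    rw [transvectionMatrix_conj] at hval
    split_ifs at hval with h
    · have : transvectionUnitary c * weylUnitary v * (transvectionUnitary c)⁻¹ = weylUnitary v :=
        Subtype.ext hval
      rw [this]
      exact weylUnitary_mem v
    · have h1 : weyl v * weyl c = - (weyl c * weyl v) := by
        rw [weyl_comm]; simp [sgn, h]
      obtain ⟨e, he⟩ := weyl_mul c v
      -- `W_c W_v` is anti-Hermitian, so that `e` is odd
      have hsq : (weyl c * weyl v) * (weyl c * weyl v) = -1 := by
        rw [mul_assoc, ← mul_assoc (weyl v), h1, neg_mul, mul_neg, mul_assoc, weyl_mul_self,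
          mul_one, weyl_mul_self]
      have hI : (Complex.I ^ e) * (Complex.I ^ e) = -1 := by
        rw [he, Matrix.smul_mul, Matrix.mul_smul, smul_smul, weyl_mul_self] at hsq
        have := congrFun (congrFun hsq 0) 0
        simpa using this
      have hcases : Complex.I * Complex.I ^ e = 1 ∨ Complex.I * Complex.I ^ e = -1 := by
        refine mul_self_eq_one_iff.1 ?_
        linear_combination Complex.I_mul_I * (Complex.I ^ e) * (Complex.I ^ e) - hI
      rw [he, smul_smul] at hval
      rcases hcases with hc | hc
      · rw [hc, one_smul] at hval
        have : transvectionUnitary c * weylUnitary v * (transvectionUnitary c)⁻¹ =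
          weylUnitary (c + v) := Subtype.ext hval
        rw [this]
        exact weylUnitary_mem _
      · rw [hc] at hval
        -- The sign `-1` lies in the Pauli group here because it is `(W_c W_v)²` for anticommuting
        -- strings.
        have : transvectionUnitary c * weylUnitary v * (transvectionUnitary c)⁻¹ =
            weylUnitary c * weylUnitary v * weylUnitary c * weylUnitary v
              * weylUnitary (c + v) := by
          refine Subtype.ext (hval.trans ?_)
          change _ = weyl c * weyl v * weyl c * weyl v * weyl (c + v)
          rw [mul_assoc (weyl c * weyl v), hsq]
          simp
        rw [this]
        exact mul_mem (mul_mem (mul_mem (mul_mem (weylUnitary_mem _) (weylUnitary_mem _))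
          (weylUnitary_mem _)) (weylUnitary_mem _)) (weylUnitary_mem _)
  exact hle hg

/-! ### Pauli strings made diagonal by a Clifford unitary -/

theorem weyl_isDiag {n : ℕ} {v : Phase n} (hv : ∀ j, (v j).1 = 0) : (weyl v).IsDiag := by
  intro x y hxy
  obtain ⟨j, hj⟩ := Function.ne_iff.1 hxy
  have key : ∀ a : ZMod 2 × ZMod 2, a.1 = 0 → a = (0, 0) ∨ a = (0, 1) := by decide
  have i0 : pauliIndex (0, 0) = 0 := by decide
  have i3 : pauliIndex (0, 1) = 3 := by decide
  refine Finset.prod_eq_zero (Finset.mem_univ j) ?_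
  change pauliMatrix (pauliIndex (v j)) (x j) (y j) = 0
  generalize x j = a at hj ⊢
  generalize y j = b at hj ⊢
  rcases key (v j) (hv j) with h | h <;> rw [h] <;> fin_cases a <;> fin_cases b <;>
    simp_all [pauliMatrix]

/-- Half of the dichotomy behind the whole computation: an `X` or `Y` factor kills every diagonal
entry, while strings without one are diagonal. -/
theorem weyl_apply_diag_eq_zero {n : ℕ} {v : Phase n} (hv : ¬ ∀ j, (v j).1 = 0) (b : Bits n) :
    weyl v b b = 0 := by
  obtain ⟨j, hj⟩ := not_forall.1 hv
  have key : ∀ a : ZMod 2 × ZMod 2, a.1 ≠ 0 → a = (1, 0) ∨ a = (1, 1) := by decide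
  have i1 : pauliIndex (1, 0) = 1 := by decide
  have i2 : pauliIndex (1, 1) = 2 := by decide
  refine Finset.prod_eq_zero (Finset.mem_univ j) ?_
  change pauliMatrix (pauliIndex (v j)) (b j) (b j) = 0
  generalize b j = a
  rcases key (v j) hj with h | h <;> rw [h] <;> fin_cases a <;> simp [i1, i2, pauliMatrix]

theorem eq_zero_of_isDiag {m : Type*} {A : Matrix m m ℂ} (h : A.IsDiag) (h0 : ∀ b, A b b = 0) :
    A = 0 := by
  ext x y
  by_cases hxy : x = y
  · subst hxy
    exact h0 x
  · exact h hxy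

theorem weyl_ne_zero {n : ℕ} (v : Phase n) : weyl v ≠ 0 := by
  intro h
  have := weyl_mul_self v
  rw [h, zero_mul] at this
  exact zero_ne_one this

theorem weyl_isDiag_iff {n : ℕ} {v : Phase n} : (weyl v).IsDiag ↔ ∀ j, (v j).1 = 0 := by
  refine ⟨fun h => ?_, weyl_isDiag⟩
  by_contra hv
  exact weyl_ne_zero v (eq_zero_of_isDiag h (weyl_apply_diag_eq_zero hv))

theorem card_weyl_isDiag (n : ℕ) :
    (Finset.univ.filter fun v : Phase n => ∀ j, (v j).1 = 0).card = 2 ^ n := by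
  have h : (Finset.univ.filter fun v : Phase n => ∀ j, (v j).1 = 0) =
      Fintype.piFinset fun _ : Fin n => Finset.univ.filter fun a : ZMod 2 × ZMod 2 => a.1 = 0 := by
    ext v
    simp [Fintype.mem_piFinset]
  have h2 : (Finset.univ.filter fun a : ZMod 2 × ZMod 2 => a.1 = 0).card = 2 := by decide
  rw [h, Fintype.card_piFinset_const, h2]

theorem isDiag_iff_of_eq_smul {m : Type*} {A B : Matrix m m ℂ} {z : ℂ} (h : A = z • B)
    (hA : A ≠ 0) : A.IsDiag ↔ B.IsDiag := by
  have hz : z ≠ 0 := by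
    rintro rfl
    exact hA (by rw [h, zero_smul])
  have hB : B = z⁻¹ • A := by rw [h, smul_smul, inv_mul_cancel₀ hz, one_smul]
  exact ⟨fun hd => hB ▸ hd.smul _, fun hd => h ▸ hd.smul _⟩

/-- Conjugation of a Pauli string by a unitary. -/
def conjWeyl {n : ℕ} (U : Matrix.unitaryGroup (Bits n) ℂ) (a : Phase n) :
    Matrix (Bits n) (Bits n) ℂ :=
  U.1 * weyl a * U.1ᴴ

theorem conjTranspose_mul_self_of_unitary {m : Type*} [Fintype m] [DecidableEq m]
    (U : Matrix.unitaryGroup m ℂ) : U.1ᴴ * U.1 = 1 :=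
  Matrix.mem_unitaryGroup_iff'.1 U.2

theorem conjWeyl_mul {n : ℕ} (U : Matrix.unitaryGroup (Bits n) ℂ) (a c : Phase n) :
    conjWeyl U a * conjWeyl U c = U.1 * (weyl a * weyl c) * U.1ᴴ := by
  have h := conjTranspose_mul_self_of_unitary U
  calc conjWeyl U a * conjWeyl U c = U.1 * weyl a * (U.1ᴴ * U.1) * weyl c * U.1ᴴ := by
        simp only [conjWeyl, mul_assoc]
    _ = _ := by rw [h, mul_one]; simp only [mul_assoc]

theorem conj_cancel {m : Type*} [Fintype m] [DecidableEq m] (U : Matrix.unitaryGroup m ℂ)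
    (A : Matrix m m ℂ) : U.1ᴴ * (U.1 * A * U.1ᴴ) * U.1 = A := by
  have h := conjTranspose_mul_self_of_unitary U
  calc U.1ᴴ * (U.1 * A * U.1ᴴ) * U.1 = (U.1ᴴ * U.1) * A * (U.1ᴴ * U.1) := by
        simp only [mul_assoc]
    _ = A := by rw [h, one_mul, mul_one]

theorem conjWeyl_ne_zero {n : ℕ} (U : Matrix.unitaryGroup (Bits n) ℂ) (a : Phase n) :
    conjWeyl U a ≠ 0 := by
  intro h
  have h1 := conj_cancel U (weyl a)
  rw [← conjWeyl, h, mul_zero, zero_mul] at h1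
  exact weyl_ne_zero a h1.symm

theorem exists_conjWeyl_eq {n : ℕ} {U : Matrix.unitaryGroup (Bits n) ℂ}
    (hU : U ∈ cliffordUnitaries n) (a : Phase n) :
    ∃ (v : Phase n) (e : ℕ), conjWeyl U a = Complex.I ^ e • weyl v :=
  mem_pauliGroup_weyl ((Subgroup.mem_normalizer_iff.1 hU _).1 (weylUnitary_mem a))

theorem conjWeyl_apply_diag_eq_zero {n : ℕ} {U : Matrix.unitaryGroup (Bits n) ℂ}
    (hU : U ∈ cliffordUnitaries n) {a : Phase n} (h : ¬ (conjWeyl U a).IsDiag) (b : Bits n) :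
    conjWeyl U a b b = 0 := by
  obtain ⟨v, e, hv⟩ := exists_conjWeyl_eq hU a
  rw [isDiag_iff_of_eq_smul hv (conjWeyl_ne_zero U a), weyl_isDiag_iff] at h
  rw [hv, Matrix.smul_apply, weyl_apply_diag_eq_zero h, smul_zero]

open Classical in
/-- The labels of the Pauli strings that a unitary makes diagonal. -/
noncomputable def diagLabels {n : ℕ} (U : Matrix.unitaryGroup (Bits n) ℂ) : Finset (Phase n) :=
  Finset.univ.filter fun a => (conjWeyl U a).IsDiag

theorem mem_diagLabels {n : ℕ} {U : Matrix.unitaryGroup (Bits n) ℂ} {a : Phase n} :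
    a ∈ diagLabels U ↔ (conjWeyl U a).IsDiag := by
  classical
  simp [diagLabels]

theorem zero_mem_diagLabels {n : ℕ} (U : Matrix.unitaryGroup (Bits n) ℂ) : 0 ∈ diagLabels U := by
  have h : U.1 * U.1ᴴ = 1 := Matrix.mem_unitaryGroup_iff.1 U.2
  rw [mem_diagLabels, conjWeyl, weyl_zero, mul_one, h]
  exact Matrix.isDiag_one

/-- Conjugation by a Clifford unitary permutes the labels, injectively since distinct strings are
trace-orthogonal. The diagonal ones correspond to strings made of `1` and `Z`. -/
theorem card_diagLabels {n : ℕ} {U : Matrix.unitaryGroup (Bits n) ℂ}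
    (hU : U ∈ cliffordUnitaries n) : (diagLabels U).card = 2 ^ n := by
  choose π e hπ using exists_conjWeyl_eq hU
  have hinj : Function.Injective π := by
    intro a c h
    have h1 : ∀ a, weyl a = Complex.I ^ e a • (U.1ᴴ * weyl (π a) * U.1) := by
      intro a
      rw [← conj_cancel U (weyl a), ← conjWeyl, hπ, Matrix.mul_smul, Matrix.smul_mul]
    have hI : Complex.I ^ e c ≠ 0 := pow_ne_zero _ Complex.I_ne_zero
    refine eq_of_weyl_eq_smul (z := Complex.I ^ e a * (Complex.I ^ e c)⁻¹) ?_
    rw [h1 a, h1 c, h, smul_smul, inv_mul_cancel_right₀ hI]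
  have hbij := Finite.injective_iff_bijective.1 hinj
  rw [← card_weyl_isDiag n]
  refine Finset.card_bij (fun a _ => π a) ?_ (fun a _ c _ h => hinj h) ?_
  · intro a ha
    rw [mem_diagLabels, isDiag_iff_of_eq_smul (hπ a) (conjWeyl_ne_zero U a),
      weyl_isDiag_iff] at ha
    simpa using ha
  · intro v hv
    obtain ⟨a, rfl⟩ := hbij.2 v
    refine ⟨a, ?_, rfl⟩
    rw [mem_diagLabels, isDiag_iff_of_eq_smul (hπ a) (conjWeyl_ne_zero U a), weyl_isDiag_iff]
    simpa using hv

theorem isDiag_mul_comm {m : Type*} [Fintype m] [DecidableEq m] {A B : Matrix m m ℂ}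
    (hA : A.IsDiag) (hB : B.IsDiag) : A * B = B * A := by
  rw [← hA.diagonal_diag, ← hB.diagonal_diag, Matrix.diagonal_mul_diagonal,
    Matrix.diagonal_mul_diagonal]
  simp only [mul_comm]

/-- Diagonal matrices commute, and commutation is preserved on conjugating back by the unitary. -/
theorem sympl_eq_zero_of_mem_diagLabels {n : ℕ} {U : Matrix.unitaryGroup (Bits n) ℂ}
    {a c : Phase n} (ha : a ∈ diagLabels U) (hc : c ∈ diagLabels U) : sympl a c = 0 := by
  rw [mem_diagLabels] at ha hc
  have h := isDiag_mul_comm ha hc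
  rw [conjWeyl_mul, conjWeyl_mul] at h
  have h1 := conj_cancel U (weyl a * weyl c)
  rw [h, conj_cancel, weyl_comm a c] at h1
  by_contra h0
  simp only [sgn, if_neg h0, neg_smul, one_smul] at h1
  have h2 : weyl c * weyl a = 0 := by
    ext x y
    have := congrFun (congrFun h1 x) y
    rw [Matrix.neg_apply] at this
    rw [Matrix.zero_apply]
    linear_combination this / 2
  have h3 : weyl c * (weyl c * weyl a) = weyl a := by rw [← mul_assoc, weyl_mul_self, one_mul]
  rw [h2, mul_zero] at h3
  exact weyl_ne_zero a h3.symm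

/-! ### Uniformly random Clifford unitaries -/

/-- Scalars are central. This makes the Clifford quotient a group, so that right multiplication can
reindex averages over it. -/
instance globalPhases_normal (n : ℕ) :
    ((globalPhases n).subgroupOf (cliffordUnitaries n)).Normal := by
  refine ⟨fun u hu g => ?_⟩
  obtain ⟨z, hz⟩ := hu
  refine ⟨z, ?_⟩
  have hz' : (u.1 : Matrix (Bits n) (Bits n) ℂ) = z • 1 := hz
  have hg : (g.1 : Matrix (Bits n) (Bits n) ℂ) * (g.1 : Matrix (Bits n) (Bits n) ℂ)ᴴ = 1 :=
    Matrix.mem_unitaryGroup_iff.1 g.1.2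
  change (g.1 : Matrix (Bits n) (Bits n) ℂ) * (u.1 : Matrix (Bits n) (Bits n) ℂ) *
    (g.1 : Matrix (Bits n) (Bits n) ℂ)ᴴ = _
  rw [hz', Matrix.mul_smul, mul_one, Matrix.smul_mul, hg]

/-- The representative of a Clifford group element that circuits use. -/
noncomputable def cliffordRep {n : ℕ} (q : CliffordGroup n) : Matrix.unitaryGroup (Bits n) ℂ :=
  (Quotient.out q : cliffordUnitaries n).1

theorem cliffordRep_mem {n : ℕ} (q : CliffordGroup n) : cliffordRep q ∈ cliffordUnitaries n :=
  (Quotient.out q : cliffordUnitaries n).2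

/-- The class of a transvection in the Clifford group. -/
noncomputable def transvectionClass {n : ℕ} (c : Phase n) : CliffordGroup n :=
  QuotientGroup.mk ⟨transvectionUnitary c, transvectionUnitary_mem c⟩

/-- The chosen representative of the product differs from the product of representatives by a phase
only, which does not affect being diagonal. -/
theorem mem_diagLabels_mul_transvection {n : ℕ} (q : CliffordGroup n) (c a : Phase n) :
    a ∈ diagLabels (cliffordRep (q * transvectionClass c)) ↔
      transvection c a ∈ diagLabels (cliffordRep q) := by
  have h1 : (QuotientGroup.mk ((Quotient.out q : cliffordUnitaries n) *
      ⟨transvectionUnitary c, transvectionUnitary_mem c⟩) : CliffordGroup n) =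
      QuotientGroup.mk (Quotient.out (q * transvectionClass c)) := by
    rw [QuotientGroup.out_eq', QuotientGroup.mk_mul, QuotientGroup.out_eq']
    rfl
  rw [QuotientGroup.eq, Subgroup.mem_subgroupOf] at h1
  obtain ⟨z, hz⟩ := h1
  have h2 : (cliffordRep (q * transvectionClass c)).1 =
      z • ((cliffordRep q).1 * transvectionMatrix c) := by
    have h3 : cliffordRep (q * transvectionClass c) =
        (cliffordRep q * transvectionUnitary c) *
        ((cliffordRep q * transvectionUnitary c)⁻¹ * cliffordRep (q * transvectionClass c)) :=
      (mul_inv_cancel_left _ _).symm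
    have h4 : (((cliffordRep q * transvectionUnitary c)⁻¹ *
        cliffordRep (q * transvectionClass c) : Matrix.unitaryGroup (Bits n) ℂ) :
        Matrix (Bits n) (Bits n) ℂ) = z • 1 := hz
    rw [h3, Matrix.UnitaryGroup.mul_val, h4, Matrix.mul_smul, mul_one]
    rfl
  obtain ⟨w, hw⟩ := transvectionMatrix_conj_eq c a
  have h5 : conjWeyl (cliffordRep (q * transvectionClass c)) a =
      (z * star z * w) • conjWeyl (cliffordRep q) (transvection c a) := by
    rw [conjWeyl, h2, Matrix.conjTranspose_smul, Matrix.conjTranspose_mul, conjWeyl]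
    have : (z • ((cliffordRep q).1 * transvectionMatrix c)) * weyl a *
        (star z • ((transvectionMatrix c)ᴴ * (cliffordRep q).1ᴴ)) =
        (z * star z) • ((cliffordRep q).1 * (transvectionMatrix c * weyl a *
          (transvectionMatrix c)ᴴ) * (cliffordRep q).1ᴴ) := by
      simp only [Matrix.smul_mul, Matrix.mul_smul, smul_smul, mul_assoc, mul_comm (star z)]
    rw [this, hw, Matrix.mul_smul, Matrix.smul_mul, smul_smul]
  rw [mem_diagLabels, mem_diagLabels, isDiag_iff_of_eq_smul h5 (conjWeyl_ne_zero _ _)]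

open Classical in
/-- The probability that a uniformly random Clifford unitary makes two given Pauli strings
diagonal. -/
noncomputable def diagProb {n : ℕ} (a c : Phase n) : ℝ :=
  (Fintype.card (CliffordGroup n) : ℝ)⁻¹ * ∑ q : CliffordGroup n,
    if a ∈ diagLabels (cliffordRep q) ∧ c ∈ diagLabels (cliffordRep q) then 1 else 0

theorem diagProb_comm {n : ℕ} (a c : Phase n) : diagProb a c = diagProb c a := by
  simp only [diagProb, and_comm]

theorem diagProb_nonneg {n : ℕ} (a c : Phase n) : 0 ≤ diagProb a c := by
  unfold diagProb
  positivity

theorem diagProb_zero_right {n : ℕ} (a : Phase n) : diagProb a 0 = diagProb a a := by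
  simp only [diagProb, zero_mem_diagLabels, and_true, and_self]

theorem diagProb_zero_zero {n : ℕ} : diagProb (0 : Phase n) 0 = 1 := by
  simp [diagProb, zero_mem_diagLabels]

theorem diagProb_eq_zero {n : ℕ} {a c : Phase n} (h : sympl a c ≠ 0) : diagProb a c = 0 := by
  rw [diagProb, Finset.sum_eq_zero, mul_zero]
  intro q _
  rw [if_neg]
  rintro ⟨ha, hc⟩
  exact h (sympl_eq_zero_of_mem_diagLabels ha hc)

/-- Right multiplication by a transvection class preserves the uniform law on the Clifford group. -/
theorem diagProb_transvection {n : ℕ} (t a c : Phase n) :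
    diagProb (transvection t a) (transvection t c) = diagProb a c := by
  simp only [diagProb]
  rw [← Equiv.sum_comp (Equiv.mulRight (transvectionClass t)) fun q : CliffordGroup n =>
    if a ∈ diagLabels (cliffordRep q) ∧ c ∈ diagLabels (cliffordRep q) then (1 : ℝ) else 0]
  simp only [Equiv.coe_mulRight, mem_diagLabels_mul_transvection]

/-- Double counting: a Clifford that makes `a` diagonal makes exactly `2 ^ n` strings diagonal. -/
theorem sum_diagProb {n : ℕ} (a : Phase n) : ∑ c, diagProb a c = 2 ^ n * diagProb a a := by
  classical
  simp only [diagProb, ← Finset.mul_sum]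
  rw [Finset.sum_comm, mul_left_comm, Finset.mul_sum Finset.univ _ ((2 : ℝ) ^ n)]
  congr 1
  refine Finset.sum_congr rfl fun q _ => ?_
  by_cases ha : a ∈ diagLabels (cliffordRep q)
  · simp [ha, card_diagLabels (cliffordRep_mem q)]
  · simp [ha]

theorem two_le_two_pow_of_ne_zero {n : ℕ} {a : Phase n} (ha : a ≠ 0) : (2 : ℝ) ≤ 2 ^ n := by
  have hn : n ≠ 0 := by
    rintro rfl
    exact ha (Subsingleton.elim _ _)
  exact_mod_cast Nat.le_self_pow hn 2

/-- By transvection invariance the value `x` is the same for all nonzero labels. Counting at the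
label `0` gives `1 + (d² - 1) x = d` with `d = 2 ^ n`. -/
theorem diagProb_self {n : ℕ} {a : Phase n} (ha : a ≠ 0) : diagProb a a = (2 ^ n + 1 : ℝ)⁻¹ := by
  have hconst : ∀ c : Phase n, c ≠ 0 → diagProb c c = diagProb a a := fun c hc =>
    transvection_invariant (u := 0) (fun v => diagProb v v)
      (fun t v _ => diagProb_transvection t v v) hc hc ha ha
      (by rw [sympl_zero_left, sympl_zero_left])
  have hsum := sum_diagProb (0 : Phase n)
  rw [diagProb_zero_zero, mul_one, Fintype.sum_eq_add_sum_compl (0 : Phase n),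
    diagProb_zero_zero] at hsum
  have h1 : ∀ c ∈ ({0}ᶜ : Finset (Phase n)), diagProb 0 c = diagProb a a := by
    intro c hc
    rw [diagProb_comm, diagProb_zero_right]
    exact hconst c (by simpa using hc)
  rw [Finset.sum_congr rfl h1, Finset.sum_const, Finset.card_compl, Finset.card_singleton,
    card_phase, nsmul_eq_mul, Nat.cast_sub (Nat.one_le_pow _ _ (by norm_num))] at hsum
  push_cast at hsum
  have h4 : (4 : ℝ) ^ n = 2 ^ n * 2 ^ n := by rw [← mul_pow]; norm_num
  rw [h4] at hsum
  have hd := two_le_two_pow_of_ne_zero ha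
  generalize (2 : ℝ) ^ n = d at hsum hd ⊢
  -- The factor `d - 1` can be cancelled because a nonzero label forces `d ≥ 2`.
  have h5 : (d - 1) * ((d + 1) * diagProb a a - 1) = 0 := by linear_combination hsum
  rcases mul_eq_zero.1 h5 with h | h
  · linarith
  · exact eq_inv_of_mul_eq_one_right (by linarith)

theorem diagProb_self_pos {n : ℕ} (a : Phase n) : 0 < diagProb a a := by
  by_cases ha : a = 0
  · subst ha
    rw [diagProb_zero_zero]
    exact one_pos
  · rw [diagProb_self ha]
    positivity

/-- Transvections along the complement of `a` fix `a`, so the value `x` is constant on the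
complement minus `0` and `a`, a set of `d² / 2 - 2` labels; off the complement the probability
vanishes. The count reads `2 / (d + 1) + (d² / 2 - 2) x = d / (d + 1)`. -/
theorem diagProb_of_ne {n : ℕ} {a c : Phase n} (ha : a ≠ 0) (hc : c ≠ 0) (hac : c ≠ a)
    (h : sympl a c = 0) : diagProb a c = 2 / ((2 ^ n + 1) * (2 ^ n + 2) : ℝ) := by
  have hconst : ∀ b : Phase n, b ≠ 0 → b ≠ a → sympl a b = 0 → diagProb a b = diagProb a c := by
    intro b hb hab hs
    refine transvection_invariant (u := a) (fun v => diagProb a v) (fun t v ht => ?_) hb hab hc hac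
      (hs.trans h.symm)
    have h1 : transvection t a = a := if_pos ht
    have h2 := diagProb_transvection t a v
    rwa [h1] at h2
  set K : Finset (Phase n) := Finset.univ.filter fun b => sympl a b = 0 with hK
  have hsub : ({0, a} : Finset (Phase n)) ⊆ K := by
    intro b hb
    rw [Finset.mem_insert, Finset.mem_singleton] at hb
    rcases hb with rfl | rfl
    · simp [hK, sympl_comm a, sympl_zero_left]
    · simp [hK, sympl_self]
  have hsub3 : insert c ({0, a} : Finset (Phase n)) ⊆ K := by
    refine Finset.insert_subset ?_ hsub
    simp [hK, h]
  have hcard := card_sympl_eq_zero ha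
  rw [← hK] at hcard
  have h2 : ({0, a} : Finset (Phase n)).card = 2 := Finset.card_pair (Ne.symm ha)
  have h3 : (insert c ({0, a} : Finset (Phase n))).card = 3 := by
    rw [Finset.card_insert_of_notMem (by simp [hc, hac]), h2]
  have hge := Finset.card_le_card hsub3
  rw [h3] at hge
  have hsum := sum_diagProb a
  rw [← Finset.sum_subset (Finset.subset_univ K), ← Finset.sum_sdiff hsub,
    Finset.sum_pair (Ne.symm ha), diagProb_zero_right] at hsum
  · have h5 : ∀ b ∈ K \ {0, a}, diagProb a b = diagProb a c := by
      intro b hb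
      simp only [hK, Finset.mem_sdiff, Finset.mem_filter, Finset.mem_univ, true_and,
        Finset.mem_insert, Finset.mem_singleton, not_or] at hb
      exact hconst b hb.2.1 hb.2.2 hb.1
    rw [Finset.sum_congr rfl h5, Finset.sum_const, Finset.card_sdiff_of_subset hsub, h2,
      nsmul_eq_mul, Nat.cast_sub (by omega), diagProb_self ha] at hsum
    have hcard' : 2 * (K.card : ℝ) = 2 ^ n * 2 ^ n := by
      rw [← mul_pow]
      norm_num
      exact_mod_cast hcard
    have hge' : (3 : ℝ) ≤ K.card := by exact_mod_cast hge
    have hd := two_le_two_pow_of_ne_zero ha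
    generalize (2 : ℝ) ^ n = d at hsum hd hcard' ⊢
    -- For `d = 2` the complement of `a` is only `{0, a}`, contradicting that it also contains `c`.
    have hd2 : d - 2 ≠ 0 := by
      intro h0
      have : d = 2 := by linarith
      rw [this] at hcard'
      linarith
    have hd1 : d + 1 ≠ 0 := by linarith
    have hd3 : d + 2 ≠ 0 := by linarith
    have hKc : (K.card : ℝ) = d * d / 2 := by linarith
    rw [hKc] at hsum
    push_cast at hsum
    rw [eq_div_iff (mul_ne_zero hd1 hd3)]
    have h6 : (d - 2) * (diagProb a c * ((d + 1) * (d + 2)) - 2) = 0 := by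
      field_simp at hsum
      linear_combination hsum
    rcases mul_eq_zero.1 h6 with h7 | h7
    · exact absurd h7 hd2
    · linarith
  · intro b _ hb
    exact diagProb_eq_zero fun h0 => hb (by simp [hK, h0])

theorem diagProb_div_self_le {n : ℕ} (a : Phase n) :
    diagProb a a / (diagProb a a * diagProb a a) ≤ 2 ^ n + 1 := by
  rw [div_mul_cancel_left₀ (diagProb_self_pos a).ne']
  by_cases ha : a = 0
  · subst ha
    rw [diagProb_zero_zero, inv_one]
    have : (0 : ℝ) ≤ 2 ^ n := by positivity
    linarith
  · rw [diagProb_self ha, inv_inv]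

/-- The ratio is `1` if one label is zero, `0` for anticommuting strings, and equal to the bound
otherwise. -/
theorem diagProb_div_le {n : ℕ} {a c : Phase n} (hac : c ≠ a) :
    diagProb a c / (diagProb a a * diagProb c c) ≤ 2 * (2 ^ n + 1) / (2 ^ n + 2 : ℝ) := by
  have hpos : (0 : ℝ) < 2 ^ n := by positivity
  have h1 : (1 : ℝ) ≤ 2 * (2 ^ n + 1) / (2 ^ n + 2 : ℝ) := by
    rw [le_div_iff₀ (by linarith)]
    linarith
  by_cases ha : a = 0
  · subst ha
    rwa [diagProb_comm, diagProb_zero_right, diagProb_zero_zero, one_mul,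
      div_self (diagProb_self_pos c).ne']
  by_cases hc : c = 0
  · subst hc
    rwa [diagProb_zero_right, diagProb_zero_zero, mul_one, div_self (diagProb_self_pos a).ne']
  by_cases h : sympl a c = 0
  · rw [diagProb_of_ne ha hc hac h, diagProb_self ha, diagProb_self hc]
    refine le_of_eq ?_
    generalize (2 : ℝ) ^ n = d at hpos
    field_simp
  · rw [diagProb_eq_zero h, zero_div]
    linarith

/-! ### Pauli strings on several blocks -/

/-- The tensor product of Pauli strings on `k` blocks. -/
def blockWeyl {n k : ℕ} (p : Fin k → Phase n) : Op n k := tensor fun i => weyl (p i)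

theorem tensor_sum {ι m : Type*} [Fintype ι] [DecidableEq ι] {J : ι → Type*}
    [∀ i, Fintype (J i)] (A : ∀ i, J i → Matrix m m ℂ) :
    tensor (fun i => ∑ j, A i j) = ∑ f : (∀ i, J i), tensor fun i => A i (f i) := by
  ext x y
  simp only [tensor, Matrix.of_apply, Matrix.sum_apply]
  rw [Finset.prod_univ_sum, Fintype.piFinset_univ]

theorem trace_tensor {ι m : Type*} [Fintype ι] [DecidableEq ι] [Fintype m]
    (A : ι → Matrix m m ℂ) : (tensor A).trace = ∏ i, (A i).trace := by
  simp only [Matrix.trace, Matrix.diag_apply, tensor, Matrix.of_apply]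
  rw [Finset.prod_univ_sum, Fintype.piFinset_univ]

theorem tensor_isDiag {ι m : Type*} [Fintype ι] {A : ι → Matrix m m ℂ}
    (h : ∀ i, (A i).IsDiag) : (tensor A).IsDiag := by
  intro x y hxy
  obtain ⟨i, hi⟩ := Function.ne_iff.1 hxy
  exact Finset.prod_eq_zero (Finset.mem_univ i) (h i hi)

theorem blockWeyl_zero {n k : ℕ} : blockWeyl (0 : Fin k → Phase n) = 1 := by
  simp [blockWeyl, weyl_zero, tensor_one]

theorem blockWeyl_conjTranspose {n k : ℕ} (p : Fin k → Phase n) :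
    (blockWeyl p)ᴴ = blockWeyl p := by
  simp [blockWeyl, tensor_conjTranspose, weyl_conjTranspose]

theorem blockWeyl_mem_unitaryGroup {n k : ℕ} (p : Fin k → Phase n) :
    blockWeyl p ∈ Matrix.unitaryGroup (Fin k → Bits n) ℂ :=
  tensor_mem_unitaryGroup _ fun i => (weylUnitary (p i)).2

theorem trace_blockWeyl_mul {n k : ℕ} (p q : Fin k → Phase n) :
    (blockWeyl p * blockWeyl q).trace = if p = q then (2 ^ n) ^ k else 0 := by
  rw [blockWeyl, blockWeyl, tensor_mul, trace_tensor]
  simp only [trace_weyl_mul]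
  split_ifs with h
  · subst h
    simp
  · obtain ⟨i, hi⟩ := Function.ne_iff.1 h
    exact Finset.prod_eq_zero (Finset.mem_univ i) (if_neg hi)

/-- Trace orthogonality gives linear independence, and the number of strings is the dimension of the
operator space. -/
theorem span_blockWeyl (n k : ℕ) :
    Submodule.span ℂ (Set.range (blockWeyl : (Fin k → Phase n) → Op n k)) = ⊤ := by
  have hli : LinearIndependent ℂ (blockWeyl : (Fin k → Phase n) → Op n k) := by
    rw [Fintype.linearIndependent_iff]
    intro g hg q
    have h := congrArg (fun A => (A * blockWeyl q).trace) hg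
    simp only [Finset.sum_mul, Matrix.trace_sum, Matrix.smul_mul, Matrix.trace_smul,
      trace_blockWeyl_mul, zero_mul, Matrix.trace_zero, smul_eq_mul, mul_ite, mul_zero] at h
    rw [Finset.sum_ite_eq' Finset.univ q, if_pos (Finset.mem_univ q)] at h
    exact (mul_eq_zero.1 h).resolve_right (by positivity)
  refine hli.span_eq_top_of_card_eq_finrank' ?_
  rw [Module.finrank_matrix]
  simp only [Fintype.card_pi, Fintype.card_prod, ZMod.card, Finset.prod_const, Finset.card_univ,
    Fintype.card_fin, Module.finrank_self, mul_one]
  rw [← mul_pow, ← mul_pow]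

/-! ### The measurement channel on Pauli strings -/

theorem circuit_conj_blockWeyl {n k : ℕ} (u : Circuit n k) (p : Fin k → Phase n) :
    u.unitary.1 * blockWeyl p * (u.unitary.1)ᴴ =
      tensor fun i => conjWeyl (cliffordRep (u i)) (p i) := by
  have h : u.unitary.1 = tensor fun i => (cliffordRep (u i)).1 := rfl
  rw [h, blockWeyl, tensor_conjTranspose, tensor_mul, tensor_mul]
  rfl

theorem circuit_conj_apply_eq_zero {n k : ℕ} {u : Circuit n k} {p : Fin k → Phase n}
    (h : ¬ ∀ i, p i ∈ diagLabels (cliffordRep (u i))) (b : Fin k → Bits n) :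
    (u.unitary.1 * blockWeyl p * (u.unitary.1)ᴴ) b b = 0 := by
  obtain ⟨i, hi⟩ := not_forall.1 h
  rw [circuit_conj_blockWeyl]
  rw [mem_diagLabels] at hi
  exact Finset.prod_eq_zero (Finset.mem_univ i)
    (conjWeyl_apply_diag_eq_zero (cliffordRep_mem _) hi _)

theorem circuit_conj_isDiag {n k : ℕ} {u : Circuit n k} {p : Fin k → Phase n}
    (h : ∀ i, p i ∈ diagLabels (cliffordRep (u i))) :
    (u.unitary.1 * blockWeyl p * (u.unitary.1)ᴴ).IsDiag := by
  rw [circuit_conj_blockWeyl]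
  exact tensor_isDiag fun i => mem_diagLabels.1 (h i)

theorem sum_smul_snapshot {n k : ℕ} (u : Circuit n k) (x : (Fin k → Bits n) → ℂ) :
    ∑ b, x b • snapshot (u, b) = (u.unitary.1)ᴴ * Matrix.diagonal x * u.unitary.1 := by
  have h : Matrix.diagonal x = ∑ b, x b • Matrix.single b b (1 : ℂ) := by
    rw [← Matrix.sum_single_eq_diagonal]
    simp [Matrix.smul_single]
  rw [h, Finset.mul_sum, Finset.sum_mul]
  simp only [snapshot, Matrix.mul_smul, Matrix.smul_mul]

open Classical in
/-- Dephasing a pair of Pauli strings in the basis measured by a circuit. -/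
theorem sum_conj_mul_conj_smul_snapshot {n k : ℕ} (u : Circuit n k) (p q : Fin k → Phase n) :
    ∑ b, ((u.unitary.1 * blockWeyl p * (u.unitary.1)ᴴ) b b *
      (u.unitary.1 * blockWeyl q * (u.unitary.1)ᴴ) b b) • snapshot (u, b) =
    (if ∀ i, p i ∈ diagLabels (cliffordRep (u i)) ∧ q i ∈ diagLabels (cliffordRep (u i))
      then (1 : ℂ) else 0) • (blockWeyl p * blockWeyl q) := by
  split_ifs with h
  · have hp := circuit_conj_isDiag fun i => (h i).1
    have hq := circuit_conj_isDiag fun i => (h i).2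
    rw [sum_smul_snapshot, one_smul]
    have h1 : Matrix.diagonal (fun b => (u.unitary.1 * blockWeyl p * (u.unitary.1)ᴴ) b b *
        (u.unitary.1 * blockWeyl q * (u.unitary.1)ᴴ) b b) =
        u.unitary.1 * (blockWeyl p * blockWeyl q) * (u.unitary.1)ᴴ := by
      rw [← Matrix.diagonal_mul_diagonal]
      have e1 := hp.diagonal_diag
      have e2 := hq.diagonal_diag
      unfold Matrix.diag at e1 e2
      rw [e1, e2]
      have hu := conjTranspose_mul_self_of_unitary u.unitary
      calc _ = u.unitary.1 * blockWeyl p * ((u.unitary.1)ᴴ * u.unitary.1) * blockWeyl q *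
            (u.unitary.1)ᴴ := by simp only [mul_assoc]
        _ = _ := by rw [hu, mul_one]; simp only [mul_assoc]
    rw [h1, conj_cancel]
  · rw [zero_smul]
    refine Finset.sum_eq_zero fun b _ => ?_
    by_cases hp : ∀ i, p i ∈ diagLabels (cliffordRep (u i))
    · rw [circuit_conj_apply_eq_zero (p := q) fun hq => h fun i => ⟨hp i, hq i⟩, mul_zero, zero_smul]
    · rw [circuit_conj_apply_eq_zero hp, zero_mul, zero_smul]

/-- The probability that a uniformly random circuit makes two given Pauli strings diagonal. -/
noncomputable def blockProb {n k : ℕ} (p q : Fin k → Phase n) : ℝ := ∏ i, diagProb (p i) (q i)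

theorem blockProb_nonneg {n k : ℕ} (p q : Fin k → Phase n) : 0 ≤ blockProb p q :=
  Finset.prod_nonneg fun _ _ => diagProb_nonneg _ _

theorem blockProb_self_pos {n k : ℕ} (p : Fin k → Phase n) : 0 < blockProb p p :=
  Finset.prod_pos fun _ _ => diagProb_self_pos _

-- The blocks are independent: the indicator is a product over blocks, and so is the uniform law on
-- circuits.
open Classical in
theorem average_indicator {n k : ℕ} (p q : Fin k → Phase n) :
    (Fintype.card (Circuit n k) : ℂ)⁻¹ * ∑ u : Circuit n k,
      (if ∀ i, p i ∈ diagLabels (cliffordRep (u i)) ∧ q i ∈ diagLabels (cliffordRep (u i))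
        then (1 : ℂ) else 0) = blockProb p q := by
  have h : ∀ u : Circuit n k,
      (if ∀ i, p i ∈ diagLabels (cliffordRep (u i)) ∧ q i ∈ diagLabels (cliffordRep (u i))
        then (1 : ℂ) else 0) = ∏ i, if p i ∈ diagLabels (cliffordRep (u i)) ∧
          q i ∈ diagLabels (cliffordRep (u i)) then (1 : ℂ) else 0 := by
    intro u
    rw [Finset.prod_ite_zero]
    simp
  simp only [h, blockProb, diagProb]
  rw [← Fintype.piFinset_univ, ← Finset.prod_univ_sum (fun _ => Finset.univ) fun i q' =>
    if p i ∈ diagLabels (cliffordRep q') ∧ q i ∈ diagLabels (cliffordRep q') then (1 : ℂ) else 0]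
  push_cast
  rw [Finset.prod_mul_distrib, Fintype.card_pi]
  simp [apply_ite Complex.ofReal]

theorem shadowChannel_blockWeyl {n k : ℕ} (p : Fin k → Phase n) :
    shadowChannel n k (blockWeyl p) = (blockProb p p : ℂ) • blockWeyl p := by
  classical
  have h : ∀ (u : Circuit n k), ∑ b : Fin k → Bits n,
      ((u.unitary.1 * blockWeyl p * (u.unitary.1)ᴴ) b b) • snapshot (u, b) =
      (if ∀ i, p i ∈ diagLabels (cliffordRep (u i)) ∧ p i ∈ diagLabels (cliffordRep (u i))
        then (1 : ℂ) else 0) • blockWeyl p := by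
    intro u
    -- The label `0` is the identity, diagonal in every basis, so pairing with it leaves a single
    -- string dephased.
    have h1 := sum_conj_mul_conj_smul_snapshot u p 0
    have hu : u.unitary.1 * (u.unitary.1)ᴴ = 1 := Matrix.mem_unitaryGroup_iff.1 u.unitary.2
    simpa only [blockWeyl_zero, mul_one, hu, Matrix.one_apply_eq, Pi.zero_apply,
      zero_mem_diagLabels, and_true, and_self] using h1
  change (Fintype.card (Circuit n k) : ℂ)⁻¹ • ∑ u : Circuit n k, ∑ b : Fin k → Bits n,
    ((u.unitary.1 * blockWeyl p * (u.unitary.1)ᴴ) b b) • snapshot (u, b) = _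
  rw [Finset.sum_congr rfl fun u _ => h u, ← Finset.sum_smul, smul_smul, average_indicator]

/-- Pauli strings span and are eigenvectors with positive eigenvalues. Surjectivity suffices in
finite dimension. -/
theorem isUnit_shadowChannel (n k : ℕ) : IsUnit (shadowChannel n k) := by
  have hsurj : Function.Surjective (shadowChannel n k) := by
    rw [← LinearMap.range_eq_top, eq_top_iff, ← span_blockWeyl, Submodule.span_le]
    rintro _ ⟨p, rfl⟩
    refine ⟨(blockProb p p : ℂ)⁻¹ • blockWeyl p, ?_⟩
    rw [map_smul, shadowChannel_blockWeyl, smul_smul, inv_mul_cancel₀, one_smul]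
    exact_mod_cast (blockProb_self_pos p).ne'
  exact (Module.End.isUnit_iff _).2 ⟨LinearMap.injective_iff_surjective.2 hsurj, hsurj⟩

theorem reconstruction_shadowChannel {n k : ℕ} (A : Op n k) :
    reconstruction n k (shadowChannel n k A) = A :=
  LinearMap.congr_fun (Ring.inverse_mul_cancel _ (isUnit_shadowChannel n k)) A

theorem shadowChannel_reconstruction {n k : ℕ} (A : Op n k) :
    shadowChannel n k (reconstruction n k A) = A :=
  LinearMap.congr_fun (Ring.mul_inverse_cancel _ (isUnit_shadowChannel n k)) A

theorem reconstruction_blockWeyl {n k : ℕ} (p : Fin k → Phase n) :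
    reconstruction n k (blockWeyl p) = (blockProb p p : ℂ)⁻¹ • blockWeyl p := by
  have h := reconstruction_shadowChannel (blockWeyl p)
  rw [shadowChannel_blockWeyl, map_smul] at h
  have h0 : (blockProb p p : ℂ) ≠ 0 := by exact_mod_cast (blockProb_self_pos p).ne'
  rw [eq_inv_smul_iff₀ h0, h]

theorem trace_snapshot_mul {n k : ℕ} (s : Shot n k) (A : Op n k) :
    (snapshot s * A).trace = (s.1.unitary.1 * A * (s.1.unitary.1)ᴴ) s.2 s.2 := by
  rw [snapshot, mul_assoc, mul_assoc, Matrix.trace_mul_comm, mul_assoc, mul_assoc,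
    Matrix.trace_single_mul, ← mul_assoc, one_smul]

theorem trace_shadowChannel_mul_eq {n k : ℕ} (A B : Op n k) :
    (shadowChannel n k A * B).trace =
      (Fintype.card (Circuit n k) : ℂ)⁻¹ * ∑ u : Circuit n k, ∑ b : Fin k → Bits n,
        (u.unitary.1 * A * (u.unitary.1)ᴴ) b b * (u.unitary.1 * B * (u.unitary.1)ᴴ) b b := by
  change (((Fintype.card (Circuit n k) : ℂ)⁻¹ • ∑ u : Circuit n k, ∑ b : Fin k → Bits n,
    ((u.unitary.1 * A * (u.unitary.1)ᴴ) b b) • snapshot (u, b)) * B).trace = _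
  rw [Matrix.smul_mul, Matrix.trace_smul, Finset.sum_mul, Matrix.trace_sum, smul_eq_mul]
  refine congrArg _ (Finset.sum_congr rfl fun u _ => ?_)
  rw [Finset.sum_mul, Matrix.trace_sum]
  refine Finset.sum_congr rfl fun b _ => ?_
  rw [Matrix.smul_mul, Matrix.trace_smul, trace_snapshot_mul, smul_eq_mul]

/-- The trace pairing expands into products of diagonal entries, symmetric in `A` and `B`.
Self-adjointness passes to the inverse, which lets the reconstruction act on the observable instead
of the snapshot. -/
theorem trace_shadowChannel_mul {n k : ℕ} (A B : Op n k) :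
    (shadowChannel n k A * B).trace = (A * shadowChannel n k B).trace := by
  rw [Matrix.trace_mul_comm A, trace_shadowChannel_mul_eq, trace_shadowChannel_mul_eq]
  refine congrArg _ (Finset.sum_congr rfl fun u _ => Finset.sum_congr rfl fun b _ => ?_)
  rw [mul_comm]

theorem trace_reconstruction_mul {n k : ℕ} (A B : Op n k) :
    (reconstruction n k A * B).trace = (A * reconstruction n k B).trace := by
  conv_lhs => rw [← shadowChannel_reconstruction B, ← trace_shadowChannel_mul,
    shadowChannel_reconstruction]

/-! ### The second moment of the single-shot values -/

theorem norm_trace_mul_unitary_le {m : Type*} [Fintype m] [DecidableEq m] (σ : DensityMatrix m)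
    {W : Matrix m m ℂ} (hW : W ∈ Matrix.unitaryGroup m ℂ) : ‖(σ.mat * W).trace‖ ≤ 1 := by
  have hre : ∀ z : ℂ, ‖z‖ = 1 → (z * (σ.mat * W).trace).re ≤ 1 := by
    intro z hz
    have hWW : W * Wᴴ = 1 := Matrix.mem_unitaryGroup_iff.1 hW
    have hzz : z * star z = 1 := by
      rw [Complex.star_def, Complex.mul_conj, Complex.normSq_eq_norm_sq, hz]; simp
    -- For `z` of modulus one, the trace of this positive operator is `2 - 2 Re (z Tr(σW))`. The
    -- bound on the modulus follows by choosing `z` to align the phase.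
    have hpos := σ.posSemidef.conjTranspose_mul_mul_same (1 - z • W)
    have htr := hpos.trace_nonneg
    have hexp : (1 - z • W) * (1 - z • W)ᴴ = (2 : ℂ) • 1 - z • W - star z • Wᴴ := by
      have h1 : (z • W) * (star z • Wᴴ) = 1 := by
        rw [Matrix.smul_mul, Matrix.mul_smul, hWW, smul_smul, hzz, one_smul]
      rw [Matrix.conjTranspose_sub, Matrix.conjTranspose_smul, Matrix.conjTranspose_one, sub_mul,
        mul_sub, mul_sub, h1, two_smul, one_mul, one_mul, mul_one]
      abel
    rw [mul_assoc, Matrix.trace_mul_comm, mul_assoc, hexp, mul_sub, mul_sub, Matrix.trace_sub,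
      Matrix.trace_sub, Matrix.mul_smul, Matrix.mul_smul, Matrix.mul_smul, Matrix.trace_smul,
      Matrix.trace_smul, Matrix.trace_smul, mul_one, σ.trace_eq_one] at htr
    have hconj : (σ.mat * Wᴴ).trace = star (σ.mat * W).trace := by
      rw [← Matrix.trace_conjTranspose, Matrix.conjTranspose_mul, σ.posSemidef.isHermitian.eq,
        Matrix.trace_mul_comm]
    rw [hconj] at htr
    have h := (Complex.le_def.1 htr).1
    simp only [smul_eq_mul, Complex.sub_re, Complex.star_def, Complex.mul_re, Complex.conj_re,
      Complex.conj_im] at h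
    norm_num at h
    rw [Complex.mul_re]
    linarith
  set t := (σ.mat * W).trace with ht
  by_cases h0 : t = 0
  · rw [h0, norm_zero]; exact zero_le_one
  · have hn : (‖t‖ : ℂ) ≠ 0 := by exact_mod_cast norm_ne_zero_iff.2 h0
    have h := hre (star t / ‖t‖) (by
      rw [norm_div, norm_star, Complex.norm_real, norm_norm, div_self (norm_ne_zero_iff.2 h0)])
    have h2 : star t / ‖t‖ * t = (‖t‖ : ℂ) := by
      rw [div_mul_eq_mul_div, mul_comm, Complex.star_def, Complex.mul_conj,
        Complex.normSq_eq_norm_sq, div_eq_iff hn]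
      push_cast; ring
    rwa [h2, Complex.ofReal_re] at h

theorem posSemidef_apply_eq_ofReal {m : Type*} [Fintype m] [DecidableEq m] (σ : DensityMatrix m)
    (b : m) : σ.mat b b = ((σ.mat b b).re : ℂ) := by
  have h := (Complex.le_def.1 (σ.posSemidef.diag_nonneg (i := b))).2
  exact Complex.ext rfl (by simpa using h.symm)

theorem trace_mul_snapshot {n k : ℕ} (σ : DensityMatrix (Fin k → Bits n)) (s : Shot n k) :
    (σ.mat * snapshot s).trace = ((σ.conj s.1.unitary).mat s.2 s.2) := by
  rw [Matrix.trace_mul_comm, trace_snapshot_mul]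
  rfl

theorem circuit_conj_apply_star {n k : ℕ} (u : Circuit n k) (p : Fin k → Phase n)
    (b : Fin k → Bits n) : star ((u.unitary.1 * blockWeyl p * (u.unitary.1)ᴴ) b b) =
      (u.unitary.1 * blockWeyl p * (u.unitary.1)ᴴ) b b := by
  rw [← Matrix.conjTranspose_apply]
  simp only [Matrix.conjTranspose_mul, Matrix.conjTranspose_conjTranspose,
    blockWeyl_conjTranspose, mul_assoc]

/-- The second moment of a combination of Pauli strings. -/
theorem shadowSecondMoment_sum {n k : ℕ} {J : Type*} [Fintype J]
    (σ : DensityMatrix (Fin k → Bits n)) (p : J → Fin k → Phase n) (β : J → ℂ) :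
    (shadowSecondMoment σ (∑ j, β j • blockWeyl (p j)) : ℂ) =
      ∑ j, ∑ l, (β j / blockProb (p j) (p j)) * star (β l / blockProb (p l) (p l)) *
        blockProb (p j) (p l) * (σ.mat * (blockWeyl (p j) * blockWeyl (p l))).trace := by
  classical
  set γ : J → ℂ := fun j => β j / blockProb (p j) (p j) with hγ
  have hB : reconstruction n k (∑ j, β j • blockWeyl (p j)) = ∑ j, γ j • blockWeyl (p j) := by
    rw [map_sum]
    refine Finset.sum_congr rfl fun j _ => ?_
    rw [map_smul, reconstruction_blockWeyl, smul_smul, hγ]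
    rfl
  have hterm : ∀ (u : Circuit n k) (b : Fin k → Bits n),
      ((((σ.conj u.unitary).mat b b).re * ‖(u.unitary.1 * reconstruction n k
        (∑ j, β j • blockWeyl (p j)) * (u.unitary.1)ᴴ) b b‖ ^ 2 : ℝ) : ℂ) =
      ∑ j, ∑ l, γ j * star (γ l) * (((u.unitary.1 * blockWeyl (p j) * (u.unitary.1)ᴴ) b b *
        (u.unitary.1 * blockWeyl (p l) * (u.unitary.1)ᴴ) b b) *
        (σ.mat * snapshot (u, b)).trace) := by
    intro u b
    have hx : (u.unitary.1 * reconstruction n k (∑ j, β j • blockWeyl (p j)) *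
        (u.unitary.1)ᴴ) b b = ∑ j, γ j * (u.unitary.1 * blockWeyl (p j) *
          (u.unitary.1)ᴴ) b b := by
      rw [hB, Finset.mul_sum, Finset.sum_mul, Matrix.sum_apply]
      simp only [Matrix.mul_smul, Matrix.smul_mul, Matrix.smul_apply, smul_eq_mul]
    rw [Complex.ofReal_mul, ← posSemidef_apply_eq_ofReal, Complex.ofReal_pow, ← Complex.mul_conj',
      hx, ← Complex.star_def, star_sum, Finset.sum_mul_sum, Finset.mul_sum]
    refine Finset.sum_congr rfl fun j _ => ?_
    rw [Finset.mul_sum]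
    refine Finset.sum_congr rfl fun l _ => ?_
    rw [star_mul', circuit_conj_apply_star, trace_mul_snapshot]
    ring
  rw [shadowSecondMoment, Complex.ofReal_mul, Complex.ofReal_sum]
  simp only [Complex.ofReal_sum (Finset.univ : Finset (Fin k → Bits n)), hterm]
  -- For a fixed circuit, the sum over outcomes is the dephasing of a pair of strings, leaving only
  -- an indicator times the expectation of their product.
  have hswap : ∀ u : Circuit n k, ∑ b : Fin k → Bits n, ∑ j, ∑ l, γ j * star (γ l) *
      (((u.unitary.1 * blockWeyl (p j) * (u.unitary.1)ᴴ) b b *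
        (u.unitary.1 * blockWeyl (p l) * (u.unitary.1)ᴴ) b b) *
        (σ.mat * snapshot (u, b)).trace) =
      ∑ j, ∑ l, γ j * star (γ l) * ((if ∀ i, p j i ∈ diagLabels (cliffordRep (u i)) ∧
        p l i ∈ diagLabels (cliffordRep (u i)) then (1 : ℂ) else 0) *
        (σ.mat * (blockWeyl (p j) * blockWeyl (p l))).trace) := by
    intro u
    rw [Finset.sum_comm]
    refine Finset.sum_congr rfl fun j _ => ?_
    rw [Finset.sum_comm]
    refine Finset.sum_congr rfl fun l _ => ?_
    have h := congrArg (fun A => (σ.mat * A).trace) (sum_conj_mul_conj_smul_snapshot u (p j) (p l))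
    simp only [Finset.mul_sum, Matrix.trace_sum, Matrix.mul_smul, Matrix.trace_smul,
      smul_eq_mul] at h
    rw [← Finset.mul_sum, h]
  rw [Finset.sum_congr rfl fun u _ => hswap u, Finset.sum_comm, Finset.mul_sum]
  refine Finset.sum_congr rfl fun j _ => ?_
  rw [Finset.sum_comm, Finset.mul_sum]
  refine Finset.sum_congr rfl fun l _ => ?_
  rw [← Finset.mul_sum, ← Finset.sum_mul, ← average_indicator (p j) (p l)]
  push_cast
  ring

/-- A product of two Pauli strings is unitary, so its expectation has modulus at most one. This
removes the dependence on the state. -/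
theorem shadowSecondMoment_le {n k : ℕ} {J : Type*} [Fintype J]
    (σ : DensityMatrix (Fin k → Bits n)) (p : J → Fin k → Phase n) (β : J → ℂ) :
    shadowSecondMoment σ (∑ j, β j • blockWeyl (p j)) ≤
      ∑ j, ∑ l, ‖β j‖ * ‖β l‖ *
        (blockProb (p j) (p l) / (blockProb (p j) (p j) * blockProb (p l) (p l))) := by
  have h := congrArg (fun z : ℂ => ‖z‖) (shadowSecondMoment_sum σ p β)
  simp only [Complex.norm_real] at h
  refine (Real.le_norm_self _).trans (h.le.trans ?_)
  refine (norm_sum_le _ _).trans (Finset.sum_le_sum fun j _ => ?_)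
  refine (norm_sum_le _ _).trans (Finset.sum_le_sum fun l _ => ?_)
  have hW := norm_trace_mul_unitary_le σ
    (mul_mem (blockWeyl_mem_unitaryGroup (p j)) (blockWeyl_mem_unitaryGroup (p l)))
  have h0 : ∀ p q : Fin k → Phase n, ‖(blockProb p q : ℂ)‖ = blockProb p q := fun p q => by
    rw [Complex.norm_real, Real.norm_of_nonneg (blockProb_nonneg p q)]
  rw [norm_mul, norm_mul, norm_mul, norm_star, norm_div, norm_div, h0, h0, h0]
  have hnn : 0 ≤ ‖β j‖ / blockProb (p j) (p j) * (‖β l‖ / blockProb (p l) (p l)) *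
      blockProb (p j) (p l) := by
    have h1 := blockProb_nonneg (p j) (p j)
    have h2 := blockProb_nonneg (p l) (p l)
    have h3 := blockProb_nonneg (p j) (p l)
    positivity
  refine (mul_le_of_le_one_right hnn hW).trans (le_of_eq ?_)
  rw [div_mul_div_comm]
  ring

/-! ### Encoded Pauli observables as averages of Pauli strings -/

/-- The ratio of the two elements is a scalar in the stabilizer with fourth power one. It cannot be
`-1`, nor `±i`, whose square is `-1`. -/
theorem StabilizerCode.eq_of_val_eq_smul {n r : ℕ} (S : StabilizerCode n r)
    {g h : S.stabilizer} {z : ℂ} (hz : z ^ 4 = 1)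
    (hgh : (g.1 : Matrix (Bits n) (Bits n) ℂ) = z • (h.1 : Matrix (Bits n) (Bits n) ℂ)) :
    g = h := by
  have hval : ((g.1 * h.1⁻¹ : Matrix.unitaryGroup (Bits n) ℂ) : Matrix (Bits n) (Bits n) ℂ) =
      z • 1 := by
    have h1 : (h.1 : Matrix (Bits n) (Bits n) ℂ) * (h.1 : Matrix (Bits n) (Bits n) ℂ)ᴴ = 1 :=
      Matrix.mem_unitaryGroup_iff.1 h.1.2
    change (g.1 : Matrix (Bits n) (Bits n) ℂ) * (h.1 : Matrix (Bits n) (Bits n) ℂ)ᴴ = _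
    rw [hgh, Matrix.smul_mul, h1]
  have hmem : g.1 * h.1⁻¹ ∈ S.stabilizer := mul_mem g.2 (inv_mem h.2)
  have hz2 : z ^ 2 * z ^ 2 = 1 := by rw [← hz]; ring
  rcases mul_self_eq_one_iff.1 hz2 with h2 | h2
  · rcases mul_self_eq_one_iff.1 ((sq z).symm.trans h2) with h3 | h3
    · rw [h3, one_smul] at hval
      exact Subtype.ext (mul_inv_eq_one.1 (Subtype.ext hval))
    · rw [h3, neg_smul, one_smul] at hval
      exact absurd hval (S.neg_one_notMem _ hmem)
  · refine absurd ?_ (S.neg_one_notMem _ (mul_mem hmem hmem))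
    rw [Matrix.UnitaryGroup.mul_val, hval, Matrix.smul_mul, one_mul, smul_smul, ← sq, h2,
      neg_smul, one_smul]

/-- Equal labels would make two stabilizer elements proportional with a power of `i`, hence equal.
This distinctness keeps the large terms with equal labels on the diagonal of the double sum. -/
theorem StabilizerCode.exists_mul_weyl_eq {n r : ℕ} (S : StabilizerCode n r) (w : Phase n) :
    ∃ (v : S.stabilizer → Phase n) (e : S.stabilizer → ℕ), Function.Injective v ∧
      ∀ g : S.stabilizer, (g.1 : Matrix (Bits n) (Bits n) ℂ) * weyl w =
        Complex.I ^ e g • weyl (v g) := by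
  have key : ∀ g : S.stabilizer, ∃ (v : Phase n) (e : ℕ),
      (g.1 : Matrix (Bits n) (Bits n) ℂ) * weyl w = Complex.I ^ e • weyl v := by
    intro g
    exact mem_pauliGroup_weyl (mul_mem (S.le_pauliGroup g.2) (weylUnitary_mem w))
  choose v e hve using key
  refine ⟨v, e, fun g h hgh => ?_, hve⟩
  have hI : ∀ m : ℕ, (Complex.I ^ m) ^ 4 = 1 := fun m => by
    rw [← pow_mul, mul_comm, pow_mul, Complex.I_pow_four, one_pow]
  have hI0 : Complex.I ^ e h ≠ 0 := pow_ne_zero _ Complex.I_ne_zero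
  refine S.eq_of_val_eq_smul (z := Complex.I ^ e g * (Complex.I ^ e h)⁻¹) ?_ ?_
  · rw [mul_pow, inv_pow, hI, hI, inv_one, mul_one]
  · have hg : ∀ g : S.stabilizer, (g.1 : Matrix (Bits n) (Bits n) ℂ) =
        Complex.I ^ e g • (weyl (v g) * weyl w) := by
      intro g
      rw [← Matrix.smul_mul, ← hve, mul_assoc, weyl_mul_self, mul_one]
    rw [hg g, hg h, hgh, smul_smul, inv_mul_cancel_right₀ hI0]

/-- A product of a code projector and a signed Pauli string is an average of Pauli strings with
phases; in each block the labels are distinct. -/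
theorem exists_codeProjector_mul_eq {n k : ℕ} (S : Fin k → StabilizerCode n 1) {O : Op n k}
    (hO : IsLogicalPauli S O) :
    ∃ (v : ∀ i, (S i).stabilizer → Phase n) (β : (∀ i, (S i).stabilizer) → ℂ),
      (∀ i, Function.Injective (v i)) ∧
      (∀ g, ‖β g‖ = ∏ i, (Fintype.card (S i).stabilizer : ℝ)⁻¹) ∧
      codeProjector S * O = ∑ g, β g • blockWeyl fun i => v i (g i) := by
  obtain ⟨⟨p, hp⟩, -⟩ := hO
  choose w hw using fun i => exists_weyl_eq (p i)
  have hO' : ∃ s : ℂ, ‖s‖ = 1 ∧ O = s • blockWeyl w := by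
    have h1 : (tensor fun i => pauliString (p i) : Op n k) = blockWeyl w := by
      simp only [hw]
      rfl
    rw [h1] at hp
    rcases hp with h | h
    · exact ⟨1, norm_one, by rw [h, one_smul]⟩
    · exact ⟨-1, by simp, by rw [h, neg_smul, one_smul]⟩
  obtain ⟨s, hs, rfl⟩ := hO'
  choose v e hv hve using fun i => (S i).exists_mul_weyl_eq (w i)
  refine ⟨v, fun g => s * ((∏ i, (Fintype.card (S i).stabilizer : ℂ)⁻¹) *
    ∏ i, Complex.I ^ e i (g i)), hv, fun g => ?_, ?_⟩
  · simp [hs, norm_prod, norm_pow]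
  · have h1 : codeProjector S * blockWeyl w =
        tensor fun i => (Fintype.card (S i).stabilizer : ℂ)⁻¹ •
          ∑ g : (S i).stabilizer, Complex.I ^ e i g • weyl (v i g) := by
      rw [codeProjector, blockWeyl, tensor_mul]
      congr 1
      funext i
      rw [StabilizerCode.projector, Matrix.smul_mul, Finset.sum_mul]
      simp only [hve]
    rw [Matrix.mul_smul, h1, tensor_smul, tensor_sum, Finset.smul_sum, Finset.smul_sum]
    refine Finset.sum_congr rfl fun g _ => ?_
    rw [tensor_smul, smul_smul, smul_smul, mul_assoc]
    rfl

/-! ### The shadow norm -/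

theorem StabilizerCode.two_mul_card {n : ℕ} (S : StabilizerCode n 1) :
    (Fintype.card S.stabilizer : ℝ) * 2 = 2 ^ n := by
  have h := S.card_mul
  rw [pow_one, Nat.card_eq_fintype_card] at h
  exact_mod_cast h

/-- With `s = d / 2` strings of weight `1 / s`, the equal pairs contribute at most `(d + 1) / s` and
the others at most `(1 - 1 / s) · 2 (d + 1) / (d + 2)`. These add up to `4 (d + 1) / (d + 2)`;
encoding a single qubit enters through `s = d / 2`. -/
theorem StabilizerCode.sum_diagProb_div_le {n : ℕ} (S : StabilizerCode n 1)
    {v : S.stabilizer → Phase n} (hv : Function.Injective v) :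
    ∑ g, ∑ h, (Fintype.card S.stabilizer : ℝ)⁻¹ * (Fintype.card S.stabilizer : ℝ)⁻¹ *
      (diagProb (v g) (v h) / (diagProb (v g) (v g) * diagProb (v h) (v h))) ≤
      (2 * 2 ^ n + 2) / (2 ^ n + 2) * 2 := by
  classical
  have hcard := S.two_mul_card
  set s : ℝ := (Fintype.card S.stabilizer : ℝ) with hs
  have hs1 : 1 ≤ s := by
    rw [hs]
    exact_mod_cast Nat.succ_le_of_lt Fintype.card_pos
  have hrow : ∀ g, ∑ h, diagProb (v g) (v h) / (diagProb (v g) (v g) * diagProb (v h) (v h)) ≤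
      (2 ^ n + 1) + (s - 1) * (2 * (2 ^ n + 1) / (2 ^ n + 2)) := by
    intro g
    rw [Fintype.sum_eq_add_sum_compl g]
    refine add_le_add (diagProb_div_self_le _) ?_
    refine (Finset.sum_le_card_nsmul _ _ _ fun h hh =>
      diagProb_div_le fun h' => ?_).trans (le_of_eq ?_)
    · simp only [Finset.mem_compl, Finset.mem_singleton] at hh
      exact hh (hv h')
    · rw [Finset.card_compl, Finset.card_singleton, nsmul_eq_mul,
        Nat.cast_sub (Nat.succ_le_of_lt Fintype.card_pos), Nat.cast_one]
  simp only [← Finset.mul_sum]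
  have hsum := Finset.sum_le_card_nsmul Finset.univ _ _ fun g _ => hrow g
  rw [Finset.card_univ, nsmul_eq_mul, ← hs] at hsum
  have hs0 : s ≠ 0 := by linarith
  refine (mul_le_mul_of_nonneg_left hsum (by positivity)).trans (le_of_eq ?_)
  rw [← hcard]
  have h2 : s * 2 + 2 ≠ 0 := by linarith
  field_simp
  ring

theorem sum_sum_prod {ι : Type*} [Fintype ι] [DecidableEq ι] {J : ι → Type*} [∀ i, Fintype (J i)]
    (F : ∀ i, J i → J i → ℝ) :
    ∑ g : (∀ i, J i), ∑ h : (∀ i, J i), ∏ i, F i (g i) (h i) = ∏ i, ∑ g, ∑ h, F i g h := by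
  rw [Finset.prod_univ_sum, Fintype.piFinset_univ]
  refine Finset.sum_congr rfl fun g _ => ?_
  rw [Finset.prod_univ_sum, Fintype.piFinset_univ]

/-- Coefficient moduli and joint probabilities are both products over blocks, so the double sum
factors. -/
theorem shadowSecondMoment_product_le {n k : ℕ} {J : Fin k → Type*} [∀ i, Fintype (J i)]
    (σ : DensityMatrix (Fin k → Bits n)) (v : ∀ i, J i → Phase n) (β : (∀ i, J i) → ℂ)
    (c : Fin k → ℝ) (hβ : ∀ g, ‖β g‖ = ∏ i, c i) :
    shadowSecondMoment σ (∑ g, β g • blockWeyl fun i => v i (g i)) ≤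
      ∏ i, ∑ g, ∑ h, c i * c i *
        (diagProb (v i g) (v i h) / (diagProb (v i g) (v i g) * diagProb (v i h) (v i h))) := by
  have key : ∀ g h : (∀ i, J i), ‖β g‖ * ‖β h‖ *
      (blockProb (fun i => v i (g i)) (fun i => v i (h i)) /
        (blockProb (fun i => v i (g i)) (fun i => v i (g i)) *
          blockProb (fun i => v i (h i)) (fun i => v i (h i)))) =
      ∏ i, (c i * c i * (diagProb (v i (g i)) (v i (h i)) /
        (diagProb (v i (g i)) (v i (g i)) * diagProb (v i (h i)) (v i (h i))))) := by
    intro g h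
    rw [hβ, hβ]
    unfold blockProb
    rw [Finset.prod_mul_distrib, Finset.prod_mul_distrib, Finset.prod_div_distrib,
      Finset.prod_mul_distrib]
  have h1 := shadowSecondMoment_le σ (fun (g : ∀ i, J i) i => v i (g i)) β
  simp only [key] at h1
  have h2 := sum_sum_prod fun i (g h : J i) => c i * c i *
        (diagProb (v i g) (v i h) / (diagProb (v i g) (v i g) * diagProb (v i h) (v i h)))
  exact h1.trans h2.le

theorem shadowSecondMoment_codeProjector_mul_le {n k : ℕ} (S : Fin k → StabilizerCode n 1)
    {O : Op n k} (hO : IsLogicalPauli S O) (σ : DensityMatrix (Fin k → Bits n)) :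
    shadowSecondMoment σ (codeProjector S * O) ≤
      ((2 * 2 ^ n + 2) / (2 ^ n + 2) * 2 : ℝ) ^ k := by
  obtain ⟨v, β, hv, hβ, hsum⟩ := exists_codeProjector_mul_eq S hO
  rw [hsum]
  have h1 := shadowSecondMoment_product_le σ v β _ hβ
  refine h1.trans ((Finset.prod_le_prod (fun i _ => ?_)
    fun i _ => (S i).sum_diagProb_div_le (hv i)).trans (le_of_eq ?_))
  · refine Finset.sum_nonneg fun g _ => Finset.sum_nonneg fun h _ => ?_
    have e1 := diagProb_nonneg (v i g) (v i h)
    have e2 := diagProb_nonneg (v i g) (v i g)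
    have e3 := diagProb_nonneg (v i h) (v i h)
    positivity
  · rw [Finset.prod_const, Finset.card_univ, Fintype.card_fin]

theorem shadowNorm_codeProjector_mul_sq_le {n k : ℕ} (S : Fin k → StabilizerCode n 1)
    {O : Op n k} (hO : IsLogicalPauli S O) :
    shadowNorm (codeProjector S * O) ^ 2 ≤ ((2 * 2 ^ n + 2) / (2 ^ n + 2) * 2 : ℝ) ^ k := by
  have h0 : (0 : ℝ) ≤ ((2 * 2 ^ n + 2) / (2 ^ n + 2) * 2 : ℝ) ^ k := by positivity
  have h : shadowNorm (codeProjector S * O) ≤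
      √(((2 * 2 ^ n + 2) / (2 ^ n + 2) * 2 : ℝ) ^ k) :=
    Real.iSup_le (fun σ => Real.sqrt_le_sqrt (shadowSecondMoment_codeProjector_mul_le S hO σ))
      (Real.sqrt_nonneg _)
  have h' : 0 ≤ shadowNorm (codeProjector S * O) := Real.iSup_nonneg fun σ => Real.sqrt_nonneg _
  exact (pow_le_pow_left₀ h' h 2).trans (le_of_eq (Real.sq_sqrt h0))

theorem shadowSecondMoment_le_four_pow {n k : ℕ} (S : Fin k → StabilizerCode n 1)
    {O : Op n k} (hO : IsLogicalPauli S O) (σ : DensityMatrix (Fin k → Bits n)) :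
    shadowSecondMoment σ (codeProjector S * O) ≤ 4 ^ k := by
  refine (shadowSecondMoment_codeProjector_mul_le S hO σ).trans
    (pow_le_pow_left₀ (by positivity) ?_ k)
  have h : (0 : ℝ) < 2 ^ n := by positivity
  rw [div_mul_eq_mul_div, div_le_iff₀ (by linarith)]
  linarith

/-! ### Code projectors and single-shot values -/

theorem StabilizerCode.projector_mul_self {n r : ℕ} (S : StabilizerCode n r) :
    S.projector * S.projector = S.projector := by
  have hg : ∀ g : S.stabilizer, (g.1 : Matrix (Bits n) (Bits n) ℂ) *
      ∑ h : S.stabilizer, (h.1 : Matrix (Bits n) (Bits n) ℂ) =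
      ∑ h : S.stabilizer, (h.1 : Matrix (Bits n) (Bits n) ℂ) := by
    intro g
    rw [Finset.mul_sum]
    exact Equiv.sum_comp (Equiv.mulLeft g)
      fun h : S.stabilizer => (h.1 : Matrix (Bits n) (Bits n) ℂ)
  have hc : (Fintype.card S.stabilizer : ℂ) ≠ 0 := Nat.cast_ne_zero.2 Fintype.card_ne_zero
  rw [StabilizerCode.projector, Matrix.smul_mul, Matrix.mul_smul, Finset.sum_mul,
    Finset.sum_congr rfl fun g _ => hg g, Finset.sum_const, Finset.card_univ,
    ← Nat.cast_smul_eq_nsmul ℂ, smul_smul _ (Fintype.card S.stabilizer : ℂ), inv_mul_cancel₀ hc,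
    one_smul]

theorem codeProjector_mul_self {n k : ℕ} (S : Fin k → StabilizerCode n 1) :
    codeProjector S * codeProjector S = codeProjector S := by
  simp only [codeProjector, tensor_mul, StabilizerCode.projector_mul_self]

/-- Commutation of `O` with the idempotent `Π` lets cyclicity of the trace absorb both projectors
into the observable. -/
theorem trace_codeProjector_conj {n k : ℕ} {S : Fin k → StabilizerCode n 1} {O : Op n k}
    (hO : IsLogicalPauli S O) (A : Op n k) :
    (codeProjector S * A * codeProjector S * O).trace = (A * (codeProjector S * O)).trace := by
  have h : O * codeProjector S = codeProjector S * O := hO.2.eq.symm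
  rw [mul_assoc, mul_assoc, Matrix.trace_mul_comm, mul_assoc, mul_assoc, h,
    ← mul_assoc (codeProjector S), codeProjector_mul_self]

/-- Self-adjointness of the reconstruction exhibits the value as the diagonal entry squared in the
shadow norm. -/
theorem singleShotEstimate_eq {n k : ℕ} {S : Fin k → StabilizerCode n 1} {O : Op n k}
    (hO : IsLogicalPauli S O) (s : Shot n k) :
    singleShotEstimate S O s = (s.1.unitary.1 * reconstruction n k (codeProjector S * O) *
      (s.1.unitary.1)ᴴ) s.2 s.2 := by
  rw [singleShotEstimate, trace_codeProjector_conj hO, trace_reconstruction_mul,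
    trace_snapshot_mul]

/-- The expectation is an average of Pauli expectations with phases. It makes the estimate `0`
sufficient when the accuracy exceeds one. -/
theorem norm_trace_codeProjector_conj_le {n k : ℕ} {S : Fin k → StabilizerCode n 1} {O : Op n k}
    (hO : IsLogicalPauli S O) (ρ : DensityMatrix (Fin k → Bits n)) :
    ‖(codeProjector S * ρ.mat * codeProjector S * O).trace‖ ≤ 1 := by
  obtain ⟨v, β, hv, hβ, hsum⟩ := exists_codeProjector_mul_eq S hO
  rw [trace_codeProjector_conj hO, hsum, Finset.mul_sum, Matrix.trace_sum]
  refine (norm_sum_le _ _).trans ((Finset.sum_le_card_nsmul _ _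
    (∏ i, (Fintype.card (S i).stabilizer : ℝ)⁻¹) fun g _ => ?_).trans (le_of_eq ?_))
  · rw [Matrix.mul_smul, Matrix.trace_smul, norm_smul, hβ]
    exact mul_le_of_le_one_right (Finset.prod_nonneg fun i _ => by positivity)
      (norm_trace_mul_unitary_le ρ (blockWeyl_mem_unitaryGroup _))
  · rw [Finset.card_univ, Fintype.card_pi, nsmul_eq_mul, Nat.cast_prod, ← Finset.prod_mul_distrib]
    exact Finset.prod_eq_one fun i _ =>
      mul_inv_cancel₀ (Nat.cast_ne_zero.2 Fintype.card_ne_zero)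

/-! ### Means of independent samples -/

section Samples

open ProbabilityTheory

variable {X : Type*} [MeasurableSpace X] [Finite X] [MeasurableSingletonClass X]

/-- The mean of the entries of `x` with indices in `T`. -/
noncomputable def finsetMean {N : ℕ} (T : Finset (Fin N)) (x : Fin N → ℂ) : ℂ :=
  (T.card : ℂ)⁻¹ * ∑ s ∈ T, x s

theorem memLp_of_finite {Y : Type*} [MeasurableSpace Y] [Finite Y] [MeasurableSingletonClass Y]
    (ν : Measure Y) [IsFiniteMeasure ν] (f : Y → ℝ) : MemLp f 2 ν :=
  MemLp.of_discrete

/-- Variances of independent terms add, and each is at most the second moment. -/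
theorem integral_sq_sum_sub_le {N : ℕ} (μ : Measure X) [IsProbabilityMeasure μ] (R : X → ℝ)
    (T : Finset (Fin N)) :
    ∫ ω, (∑ s ∈ T, R (ω s) - T.card * ∫ x, R x ∂μ) ^ 2 ∂Measure.pi (fun _ : Fin N => μ) ≤
      T.card * ∫ x, R x ^ 2 ∂μ := by
  have hind := iIndepFun_pi (μ := fun _ : Fin N => μ) (X := fun _ : Fin N => R)
    fun _ => (measurable_of_finite R).aemeasurable
  have hvar := IndepFun.variance_sum (s := T) (X := fun s (ω : Fin N → X) => R (ω s))
    (μ := Measure.pi fun _ : Fin N => μ) (fun s _ => memLp_of_finite _ _)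
    fun s _ t _ hst => hind.indepFun hst
  have hone : ∀ s : Fin N, Var[fun ω : Fin N → X => R (ω s); Measure.pi fun _ : Fin N => μ] ≤
      ∫ x, R x ^ 2 ∂μ := by
    intro s
    rw [(measurePreserving_eval (fun _ : Fin N => μ) s).variance_fun_comp
      (measurable_of_finite R).aemeasurable]
    exact variance_le_expectation_sq (measurable_of_finite R).aestronglyMeasurable
  have hE : ∫ ω, (∑ s ∈ T, fun ω : Fin N → X => R (ω s)) ω ∂Measure.pi (fun _ : Fin N => μ) =
      T.card * ∫ x, R x ∂μ := by
    simp only [Finset.sum_apply]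
    rw [integral_finsetSum _ fun s _ => Integrable.of_finite]
    rw [Finset.sum_congr rfl fun s _ => integral_comp_eval (μ := fun _ : Fin N => μ) (i := s)
      (measurable_of_finite R).aestronglyMeasurable]
    simp
  rw [variance_eq_integral (measurable_of_finite _).aemeasurable, hE] at hvar
  simp only [Finset.sum_apply] at hvar
  rw [hvar]
  refine (Finset.sum_le_card_nsmul _ _ _ fun s _ => hone s).trans (le_of_eq ?_)
  rw [nsmul_eq_mul]

/-- Chebyshev's inequality for the mean of independent samples of a complex random variable. -/
theorem measure_finsetMean_le {N : ℕ} (μ : Measure X) [IsProbabilityMeasure μ] {Z : X → ℂ}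
    {V δ : ℝ} (hV : ∫ x, ‖Z x‖ ^ 2 ∂μ ≤ V) {T : Finset (Fin N)} (hT : T.Nonempty) (hδ : 0 < δ) :
    Measure.pi (fun _ : Fin N => μ)
      {ω | δ ≤ ‖finsetMean T (fun s => Z (ω s)) - ∫ x, Z x ∂μ‖} ≤
      ENNReal.ofReal (V / (T.card * δ ^ 2)) := by
  set ν := Measure.pi (fun _ : Fin N => μ) with hν
  set c : ℝ := (T.card : ℝ) with hc
  have hc0 : 0 < c := by
    rw [hc]; exact_mod_cast hT.card_pos
  have hre : (∫ x, Z x ∂μ).re = ∫ x, (Z x).re ∂μ :=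
    (integral_re (𝕜 := ℂ) Integrable.of_finite).symm
  have him : (∫ x, Z x ∂μ).im = ∫ x, (Z x).im ∂μ :=
    (integral_im (𝕜 := ℂ) Integrable.of_finite).symm
  have h1 := integral_sq_sum_sub_le μ (fun x => (Z x).re) T
  have h2 := integral_sq_sum_sub_le μ (fun x => (Z x).im) T
  have hnorm : ∀ ω : Fin N → X, c ^ 2 * ‖finsetMean T (fun s => Z (ω s)) - ∫ x, Z x ∂μ‖ ^ 2 =
      (∑ s ∈ T, (Z (ω s)).re - c * ∫ x, (Z x).re ∂μ) ^ 2 +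
        (∑ s ∈ T, (Z (ω s)).im - c * ∫ x, (Z x).im ∂μ) ^ 2 := by
    intro ω
    have hz : (c : ℂ) * (finsetMean T (fun s => Z (ω s)) - ∫ x, Z x ∂μ) =
        ∑ s ∈ T, Z (ω s) - c * ∫ x, Z x ∂μ := by
      have : (c : ℂ) ≠ 0 := by exact_mod_cast hc0.ne'
      have hc' : (T.card : ℂ) = (c : ℂ) := by rw [hc]; simp
      rw [finsetMean, hc', mul_sub, mul_inv_cancel_left₀ this]
    have h3 := congrArg (fun z : ℂ => ‖z‖ ^ 2) hz
    simp only [norm_mul, mul_pow, Complex.norm_real, Real.norm_of_nonneg hc0.le] at h3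
    rw [h3, ← Complex.normSq_eq_norm_sq, Complex.normSq_apply]
    simp only [Complex.sub_re, Complex.sub_im, Complex.re_sum, Complex.im_sum,
      Complex.re_ofReal_mul, Complex.im_ofReal_mul, hre, him]
    ring
  have hint : ∫ ω, ‖finsetMean T (fun s => Z (ω s)) - ∫ x, Z x ∂μ‖ ^ 2 ∂ν ≤ V / c := by
    have h4 : ∫ ω, c ^ 2 * ‖finsetMean T (fun s => Z (ω s)) - ∫ x, Z x ∂μ‖ ^ 2 ∂ν ≤ c * V := by
      simp only [hnorm]
      rw [integral_add Integrable.of_finite Integrable.of_finite]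
      have h5 : ∫ x, ‖Z x‖ ^ 2 ∂μ = ∫ x, (Z x).re ^ 2 ∂μ + ∫ x, (Z x).im ^ 2 ∂μ := by
        rw [← integral_add Integrable.of_finite Integrable.of_finite]
        congr 1
        funext x
        rw [← Complex.normSq_eq_norm_sq, Complex.normSq_apply]
        ring
      have h6 := mul_le_mul_of_nonneg_left hV hc0.le
      rw [h5] at h6
      linarith
    rw [integral_const_mul] at h4
    rw [le_div_iff₀ hc0]
    refine le_of_mul_le_mul_left ?_ hc0
    linarith
  have hmarkov := mul_meas_ge_le_integral_of_nonneg (μ := ν)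
    (f := fun ω => ‖finsetMean T (fun s => Z (ω s)) - ∫ x, Z x ∂μ‖ ^ 2)
    (Filter.Eventually.of_forall fun ω => by positivity) Integrable.of_finite (δ ^ 2)
  have hset : {ω : Fin N → X | δ ≤ ‖finsetMean T (fun s => Z (ω s)) - ∫ x, Z x ∂μ‖} =
      {ω | δ ^ 2 ≤ ‖finsetMean T (fun s => Z (ω s)) - ∫ x, Z x ∂μ‖ ^ 2} := by
    ext ω
    exact (pow_le_pow_iff_left₀ hδ.le (norm_nonneg _) two_ne_zero).symm
  rw [hset, ← ofReal_measureReal]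
  refine ENNReal.ofReal_le_ofReal ?_
  rw [← div_div, le_div_iff₀ (by positivity)]
  linarith

/-- A set depending only on some coordinates is the preimage of its image under restriction to them,
so independence of coordinate families applies. -/
theorem measure_inter_of_disjoint {N : ℕ} (μ : Measure X) [IsProbabilityMeasure μ]
    {S T : Finset (Fin N)} (hST : Disjoint S T) {A B : Set (Fin N → X)}
    (hA : ∀ ω ω', (∀ s ∈ S, ω s = ω' s) → ω ∈ A → ω' ∈ A)
    (hB : ∀ ω ω', (∀ s ∈ T, ω s = ω' s) → ω ∈ B → ω' ∈ B) :
    Measure.pi (fun _ : Fin N => μ) (A ∩ B) =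
      Measure.pi (fun _ : Fin N => μ) A * Measure.pi (fun _ : Fin N => μ) B := by
  have hind := iIndepFun_pi (μ := fun _ : Fin N => μ) (X := fun _ : Fin N => (id : X → X))
    fun _ => aemeasurable_id
  have h := hind.indepFun_finset S T hST fun s => measurable_pi_apply s
  have hpre : ∀ (S : Finset (Fin N)) (A : Set (Fin N → X)),
      (∀ ω ω', (∀ s ∈ S, ω s = ω' s) → ω ∈ A → ω' ∈ A) →
      (fun (ω : Fin N → X) (s : S) => id (ω s)) ⁻¹'
        ((fun (ω : Fin N → X) (s : S) => id (ω s)) '' A) = A := by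
    intro S A hA
    refine Set.Subset.antisymm ?_ (Set.subset_preimage_image _ _)
    rintro ω ⟨ω', hω', heq⟩
    exact hA ω' ω (fun s hs => congrFun heq ⟨s, hs⟩) hω'
  have h1 := h.measure_inter_preimage_eq_mul _ _
    (Set.toFinite ((fun (ω : Fin N → X) (s : S) => id (ω s)) '' A)).measurableSet
    (Set.toFinite ((fun (ω : Fin N → X) (s : T) => id (ω s)) '' B)).measurableSet
  rwa [hpre S A hA, hpre T B hB] at h1

theorem measure_biInter_of_pairwise_disjoint {N K : ℕ} (μ : Measure X) [IsProbabilityMeasure μ]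
    {T : Fin K → Finset (Fin N)} (hT : ∀ g h, g ≠ h → Disjoint (T g) (T h))
    {B : Fin K → Set (Fin N → X)}
    (hB : ∀ g ω ω', (∀ s ∈ T g, ω s = ω' s) → ω ∈ B g → ω' ∈ B g) (G : Finset (Fin K)) :
    Measure.pi (fun _ : Fin N => μ) (⋂ g ∈ G, B g) =
      ∏ g ∈ G, Measure.pi (fun _ : Fin N => μ) (B g) := by
  classical
  induction G using Finset.induction_on with
  | empty => simp
  | insert g G hg ih =>
    rw [Finset.set_biInter_insert, Finset.prod_insert hg, ← ih]
    refine measure_inter_of_disjoint μ (S := T g) (T := G.biUnion T) ?_ (hB g) ?_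
    · rw [Finset.disjoint_biUnion_right]
      intro h hh
      exact hT g h fun h' => hg (h' ▸ hh)
    · intro ω ω' h hω
      rw [Set.mem_iInter₂] at hω ⊢
      intro g' hg'
      exact hB g' ω ω' (fun s hs => h s (Finset.mem_biUnion.2 ⟨g', hg', hs⟩)) (hω g' hg')

open Classical in
/-- If independent events are unlikely, then rarely at least half of them occur. -/
theorem measure_half_le {N K : ℕ} (μ : Measure X) [IsProbabilityMeasure μ]
    {T : Fin K → Finset (Fin N)} (hT : ∀ g h, g ≠ h → Disjoint (T g) (T h))
    {B : Fin K → Set (Fin N → X)}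
    (hB : ∀ g ω ω', (∀ s ∈ T g, ω s = ω' s) → ω ∈ B g → ω' ∈ B g)
    (hq : ∀ g, Measure.pi (fun _ : Fin N => μ) (B g) ≤ ENNReal.ofReal (1 / 16)) :
    Measure.pi (fun _ : Fin N => μ)
      {ω | K ≤ 2 * (Finset.univ.filter fun g => ω ∈ B g).card} ≤
      ENNReal.ofReal ((1 / 2) ^ K) := by
  set ν := Measure.pi (fun _ : Fin N => μ)
  -- Union bound over the sets `G` of at least `K / 2` events: each costs at most `(1 / 16) ^ (K /
  -- 2) = (1 / 4) ^ K`, and there are at most `2 ^ K` of them.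
  have hsub : {ω | K ≤ 2 * (Finset.univ.filter fun g => ω ∈ B g).card} ⊆
      ⋃ G ∈ Finset.univ.filter (fun G : Finset (Fin K) => K ≤ 2 * G.card), ⋂ g ∈ G, B g := by
    intro ω hω
    refine Set.mem_iUnion₂.2 ⟨Finset.univ.filter fun g => ω ∈ B g, ?_, ?_⟩
    · simpa using hω
    · rw [Set.mem_iInter₂]
      intro g hg
      simpa using hg
  have hG : ∀ G ∈ Finset.univ.filter (fun G : Finset (Fin K) => K ≤ 2 * G.card),
      ν (⋂ g ∈ G, B g) ≤ ENNReal.ofReal ((1 / 4) ^ K) := by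
    intro G hG
    rw [measure_biInter_of_pairwise_disjoint μ hT hB]
    refine (Finset.prod_le_pow_card _ _ _ fun g _ => hq g).trans ?_
    rw [← ENNReal.ofReal_pow (by norm_num)]
    refine ENNReal.ofReal_le_ofReal ?_
    have h : (1 / 16 : ℝ) = (1 / 4) ^ 2 := by norm_num
    rw [h, ← pow_mul]
    exact pow_le_pow_of_le_one (by norm_num) (by norm_num) (by simpa using hG)
  calc ν _ ≤ ν (⋃ G ∈ Finset.univ.filter (fun G : Finset (Fin K) => K ≤ 2 * G.card),
        ⋂ g ∈ G, B g) := measure_mono hsub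
    _ ≤ ∑ G ∈ Finset.univ.filter (fun G : Finset (Fin K) => K ≤ 2 * G.card),
        ν (⋂ g ∈ G, B g) := measure_biUnion_finset_le _ _
    _ ≤ ∑ G ∈ Finset.univ.filter (fun G : Finset (Fin K) => K ≤ 2 * G.card),
        ENNReal.ofReal ((1 / 4) ^ K) := Finset.sum_le_sum hG
    _ ≤ ∑ _G : Finset (Fin K), ENNReal.ofReal ((1 / 4) ^ K) :=
        Finset.sum_le_sum_of_subset (Finset.subset_univ _)
    _ = ENNReal.ofReal ((1 / 2) ^ K) := by
        rw [Finset.sum_const, Finset.card_univ, Fintype.card_finset, Fintype.card_fin,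
          ← ENNReal.ofReal_nsmul, nsmul_eq_mul, Nat.cast_pow, ← mul_pow]
        norm_num

end Samples

/-! ### Majority estimates from group means -/

/-- `w` is within `δ / 2` of the means of more than half of the groups. -/
def IsMajorityPoint {N K : ℕ} (T : Fin K → Finset (Fin N)) (δ : ℝ) (x : Fin N → ℂ) (w : ℂ) :
    Prop :=
  ∃ G : Finset (Fin K), K < 2 * G.card ∧ ∀ g ∈ G, ‖finsetMean (T g) x - w‖ < δ / 2

open Classical in
/-- A point close to the means of more than half of the groups, a substitute for their median. -/
noncomputable def majorityEstimate {N K : ℕ} (T : Fin K → Finset (Fin N)) (δ : ℝ)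
    (x : Fin N → ℂ) : ℂ :=
  -- The default only occurs in the failure event, where no majority point exists.
  if h : ∃ w, IsMajorityPoint T δ x w then h.choose else 0

/-- Two sets of more than half of the groups share a group, whose mean is within `δ / 2` of both
points. This replaces the median and works for complex values. -/
theorem norm_majorityEstimate_sub_lt {N K : ℕ} {T : Fin K → Finset (Fin N)} {δ : ℝ}
    {x : Fin N → ℂ} {w : ℂ} (hw : IsMajorityPoint T δ x w) :
    ‖majorityEstimate T δ x - w‖ < δ := by
  classical
  have hex : ∃ w, IsMajorityPoint T δ x w := ⟨w, hw⟩
  rw [majorityEstimate, dif_pos hex]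
  obtain ⟨G, hG, hGw⟩ := hw
  obtain ⟨G', hG', hGw'⟩ := hex.choose_spec
  have hne : (G ∩ G').Nonempty := by
    rw [← Finset.card_pos]
    have h1 := Finset.card_union_add_card_inter G G'
    have h2 : (G ∪ G').card ≤ K := by simpa using Finset.card_le_univ (G ∪ G')
    omega
  obtain ⟨g, hg⟩ := hne
  rw [Finset.mem_inter] at hg
  have h1 := hGw g hg.1
  have h2 := hGw' g hg.2
  calc ‖hex.choose - w‖ = ‖(finsetMean (T g) x - w) - (finsetMean (T g) x - hex.choose)‖ := by
        congr 1; ring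
    _ ≤ ‖finsetMean (T g) x - w‖ + ‖finsetMean (T g) x - hex.choose‖ := norm_sub_le _ _
    _ < δ := by linarith

theorem measure_majorityEstimate_le {X : Type*} [MeasurableSpace X] [Finite X]
    [MeasurableSingletonClass X] {N K : ℕ} (μ : Measure X) [IsProbabilityMeasure μ] {Z : X → ℂ}
    {V δ : ℝ} (hV : ∫ x, ‖Z x‖ ^ 2 ∂μ ≤ V) (hδ : 0 < δ) {T : Fin K → Finset (Fin N)}
    (hT : ∀ g h, g ≠ h → Disjoint (T g) (T h)) (hne : ∀ g, (T g).Nonempty)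
    (hcard : ∀ g, 64 * V ≤ (T g).card * δ ^ 2) :
    Measure.pi (fun _ : Fin N => μ)
      {ω | δ ≤ ‖majorityEstimate T δ (fun s => Z (ω s)) - ∫ x, Z x ∂μ‖} ≤
      ENNReal.ofReal ((1 / 2) ^ K) := by
  classical
  let B : Fin K → Set (Fin N → X) := fun g =>
    {ω | δ / 2 ≤ ‖finsetMean (T g) (fun s => Z (ω s)) - ∫ x, Z x ∂μ‖}
  have hB : ∀ g ω ω', (∀ s ∈ T g, ω s = ω' s) → ω ∈ B g → ω' ∈ B g := by
    intro g ω ω' h hω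
    have h1 : finsetMean (T g) (fun s => Z (ω s)) = finsetMean (T g) (fun s => Z (ω' s)) := by
      rw [finsetMean, finsetMean, Finset.sum_congr rfl fun s hs => by rw [h s hs]]
    simp only [B, Set.mem_ofPred_eq] at hω ⊢
    rwa [← h1]
  have hq : ∀ g, Measure.pi (fun _ : Fin N => μ) (B g) ≤ ENNReal.ofReal (1 / 16) := by
    intro g
    -- Chebyshev at accuracy `δ / 2` gives `4V / (|T g| δ²)`; the constant `64` makes this at most
    -- `1 / 16`.
    refine (measure_finsetMean_le μ hV (hne g) (half_pos hδ)).trans (ENNReal.ofReal_le_ofReal ?_)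
    have h0 : (0 : ℝ) < (T g).card := by exact_mod_cast (hne g).card_pos
    rw [div_le_iff₀ (by positivity)]
    have := hcard g
    nlinarith
  -- If fewer than half of the groups are bad, the good ones make the true mean a majority point,
  -- and the estimate is close to it.
  refine (measure_mono ?_).trans (measure_half_le μ hT hB hq)
  intro ω hω
  by_contra hcon
  rw [Set.mem_ofPred_eq, not_le] at hcon
  refine absurd hω (not_le.2 (norm_majorityEstimate_sub_lt
    ⟨(Finset.univ.filter fun g => ω ∈ B g)ᶜ, ?_, fun g hg => ?_⟩))
  · rw [Finset.card_compl, Fintype.card_fin]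
    omega
  · simpa [B] using hg

/-- Consecutive groups of `m` indices. -/
def consecutiveGroup (N m : ℕ) (g : ℕ) : Finset (Fin N) :=
  Finset.univ.filter fun s : Fin N => (s : ℕ) / m = g

theorem le_card_consecutiveGroup {N m K g : ℕ} (hKm : K * m ≤ N) (hg : g < K) :
    m ≤ (consecutiveGroup N m g).card := by
  have hlt : ∀ j : Fin m, g * m + j < N := fun j => by
    have h1 : (g + 1) * m ≤ K * m := Nat.mul_le_mul_right m hg
    have h2 := j.2
    rw [add_mul, one_mul] at h1
    omega
  have h := Finset.card_le_card_of_injOn (s := (Finset.univ : Finset (Fin m)))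
    (t := consecutiveGroup N m g) (fun j => ⟨g * m + j, hlt j⟩) ?_ ?_
  · simpa using h
  · intro j _
    have hm : 0 < m := lt_of_le_of_lt (Nat.zero_le _) j.2
    simp only [consecutiveGroup, Finset.coe_filter, Finset.mem_univ, true_and, Set.mem_ofPred_eq]
    rw [mul_comm, Nat.mul_add_div hm, Nat.div_eq_of_lt j.2, add_zero]
  · intro i _ j _ hij
    simp only [Fin.mk.injEq] at hij
    exact Fin.ext (by omega)

theorem disjoint_consecutiveGroup {N m g h : ℕ} (hgh : g ≠ h) :
    Disjoint (consecutiveGroup N m g) (consecutiveGroup N m h) := by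
  rw [Finset.disjoint_left]
  intro s hs hs'
  simp only [consecutiveGroup, Finset.mem_filter, Finset.mem_univ, true_and] at hs hs'
  exact hgh (hs.symm.trans hs')

/-- The number and the size of the groups used for a given number of samples. -/
theorem exists_group_sizes {M N : ℕ} {V ε δ : ℝ} (hV : 1 ≤ V) (hε : 0 < ε) (hε1 : ε ≤ 1)
    (hδ : 0 < δ) (hδ1 : δ ≤ 1)
    (hN : 1000 * (Real.log (max M 2 : ℕ) * V / (ε * δ ^ 2)) ≤ N) :
    ∃ K m : ℕ, 0 < m ∧ K * m ≤ N ∧ M * (1 / 2 : ℝ) ^ K ≤ ε ∧ 64 * V ≤ m * δ ^ 2 := by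
  set M' : ℝ := ((max M 2 : ℕ) : ℝ) with hM'
  have hM2 : 2 ≤ M' := by rw [hM']; exact_mod_cast le_max_right M 2
  have hMM : (M : ℝ) ≤ M' := by rw [hM']; exact_mod_cast le_max_left M 2
  have hl2 : 0.6931471803 < Real.log 2 := Real.log_two_gt_d9
  have hL : Real.log 2 ≤ Real.log M' := Real.log_le_log (by norm_num) hM2
  set L := Real.log M' with hLdef
  set t := L / ε with ht
  have hLt : L ≤ t := by
    rw [ht, le_div_iff₀ hε]
    nlinarith
  have hεt : Real.log 2 / ε ≤ t := div_le_div_of_nonneg_right hL hε.le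
  have hlogε : -Real.log ε ≤ 1 / ε := by
    have := Real.log_le_sub_one_of_pos (show 0 < ε⁻¹ by positivity)
    rw [Real.log_inv] at this
    rw [one_div]
    linarith
  have h1ε : (1 : ℝ) / ε * Real.log 2 ≤ t := by rw [one_div_mul_eq_div]; exact hεt
  have hx0 : 0 < M' / ε := by positivity
  -- The least number of groups for which the union bound `M' / 2 ^ K ≤ ε` holds.
  set K := ⌈Real.logb 2 (M' / ε)⌉₊ with hK
  have hlogb : Real.logb 2 (M' / ε) * Real.log 2 = L - Real.log ε := by
    rw [Real.logb, div_mul_cancel₀ _ (by linarith), Real.log_div (by linarith) hε.ne']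
  have hlogpos : 0 < Real.logb 2 (M' / ε) :=
    Real.logb_pos (by norm_num) (by rw [lt_div_iff₀ hε]; linarith)
  have hK0 : 0 < K := Nat.ceil_pos.2 hlogpos
  -- As `log (1 / ε) ≤ 1 / ε`, the logarithm and the rounding are all multiples of `t = L / ε`. The
  -- number `1.4427` bounds `1 / log 2`.
  have hKle : (K : ℝ) ≤ 6 * t := by
    have h1 := (Nat.ceil_lt_add_one hlogpos.le).le
    have h2 : (1 : ℝ) / ε ≤ 1.4427 * t := by nlinarith [show 0 < 1 / ε by positivity]
    have h3 : Real.logb 2 (M' / ε) ≤ 1.4427 * (2.4427 * t) := by nlinarith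
    have h4 : (1 : ℝ) ≤ 1.4427 * t := by
      have : (1 : ℝ) ≤ 1 / ε := by rw [le_div_iff₀ hε]; linarith
      linarith
    linarith
  have hKpow : M' * (1 / 2 : ℝ) ^ K ≤ ε := by
    have h1 : M' / ε ≤ 2 ^ K := by
      rw [← Real.rpow_natCast, ← Real.logb_le_iff_le_rpow (by norm_num) hx0]
      exact Nat.le_ceil _
    rw [div_le_iff₀ hε] at h1
    rw [one_div, inv_pow, ← div_eq_mul_inv, div_le_iff₀ (by positivity)]
    linarith
  have ht0 : 0 < t := by linarith
  have hN' : 1000 * (t * V) ≤ N * δ ^ 2 := by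
    have h1 : Real.log M' * V / (ε * δ ^ 2) = t * V / δ ^ 2 := by
      rw [ht, hLdef]; field_simp
    rw [← hLdef] at h1
    rw [h1, ← mul_div_assoc, div_le_iff₀ (by positivity)] at hN
    exact hN
  have hKN : K ≤ N := by
    have h1 : (N : ℝ) * δ ^ 2 ≤ N := mul_le_of_le_one_right (Nat.cast_nonneg _)
      (pow_le_one₀ hδ.le hδ1)
    have h2 : t ≤ t * V := le_mul_of_one_le_right ht0.le hV
    exact_mod_cast (show (K : ℝ) ≤ N by linarith)
  refine ⟨K, N / K, Nat.div_pos hKN hK0, Nat.mul_div_le N K, ?_, ?_⟩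
  · exact (mul_le_mul_of_nonneg_right hMM (by positivity)).trans hKpow
  · have hm : 1 ≤ N / K := Nat.div_pos hKN hK0
    have h1 : N < K * (N / K + 1) := Nat.lt_mul_div_succ N hK0
    -- Rounding down the group size loses at most a factor of two, so `N ≤ 12 t m`. The constant
    -- `1000` then suffices since `12 · 64 < 1000`.
    have h2 : N ≤ K * (2 * (N / K)) := h1.le.trans (Nat.mul_le_mul_left K (by omega))
    have h3 : (N : ℝ) ≤ K * (2 * ((N / K : ℕ) : ℝ)) := by exact_mod_cast h2
    set m : ℝ := ((N / K : ℕ) : ℝ)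
    have hm0 : 0 ≤ m := Nat.cast_nonneg _
    have h4 : (N : ℝ) ≤ 12 * t * m := by nlinarith
    have h5 : 1000 * (t * V) ≤ 12 * t * m * δ ^ 2 :=
      hN'.trans (mul_le_mul_of_nonneg_right h4 (by positivity))
    have h6 : t * (64 * V) ≤ t * (m * δ ^ 2) := by
      have : 0 ≤ t * V := by positivity
      linarith
    exact le_of_mul_le_mul_left h6 ht0

/-! ### The law of the single-shot values -/

instance cliffordGroup_discrete (n : ℕ) : DiscreteMeasurableSpace (CliffordGroup n) :=
  ⟨fun _ => trivial⟩

theorem shotLaw_apply {n k : ℕ} (ρ : DensityMatrix (Fin k → Bits n)) (u : Circuit n k)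
    (b : Fin k → Bits n) : shotLaw ρ (u, b) =
      (Fintype.card (Circuit n k) : ℝ≥0∞)⁻¹ *
        ENNReal.ofReal (((ρ.conj u.unitary).mat b b).re) := by
  classical
  rw [shotLaw, PMF.bind_apply, tsum_eq_single u]
  · rw [PMF.uniformOfFintype_apply, PMF.map_apply, tsum_eq_single b]
    · rw [if_pos rfl]
      rfl
    · intro b' hb'
      rw [if_neg fun h => hb' (Prod.ext_iff.1 h).2.symm]
  · intro u' hu'
    rw [PMF.map_apply, ENNReal.tsum_eq_zero.2, mul_zero]
    intro b'
    rw [if_neg fun h => hu' (Prod.ext_iff.1 h).1.symm]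

theorem shotLaw_toReal {n k : ℕ} (ρ : DensityMatrix (Fin k → Bits n)) (u : Circuit n k)
    (b : Fin k → Bits n) : (shotLaw ρ (u, b)).toReal =
      (Fintype.card (Circuit n k) : ℝ)⁻¹ * ((ρ.conj u.unitary).mat b b).re := by
  rw [shotLaw_apply, ENNReal.toReal_mul, ENNReal.toReal_inv, ENNReal.toReal_natCast,
    ENNReal.toReal_ofReal]
  exact (Complex.le_def.1 (ρ.conj u.unitary).posSemidef.diag_nonneg).1

theorem integral_shotLaw {n k : ℕ} {E : Type*} [NormedAddCommGroup E] [NormedSpace ℝ E]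
    [CompleteSpace E] (ρ : DensityMatrix (Fin k → Bits n)) (f : Shot n k → E) :
    ∫ s, f s ∂(shotLaw ρ).toMeasure = ∑ u, ∑ b,
      ((Fintype.card (Circuit n k) : ℝ)⁻¹ * ((ρ.conj u.unitary).mat b b).re) • f (u, b) := by
  rw [PMF.integral_eq_sum, Fintype.sum_prod_type]
  simp only [shotLaw_toReal]

/-- Unbiasedness: the mean is the trace pairing of the channel applied to `ρ` with the
reconstruction of `ΠO`, and self-adjointness cancels the two maps. -/
theorem integral_singleShotEstimate {n k : ℕ} {S : Fin k → StabilizerCode n 1} {O : Op n k}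
    (hO : IsLogicalPauli S O) (ρ : DensityMatrix (Fin k → Bits n)) :
    ∫ s, singleShotEstimate S O s ∂(shotLaw ρ).toMeasure =
      (codeProjector S * ρ.mat * codeProjector S * O).trace := by
  rw [integral_shotLaw, trace_codeProjector_conj hO,
    ← shadowChannel_reconstruction (codeProjector S * O), ← trace_shadowChannel_mul,
    trace_shadowChannel_mul_eq, Finset.mul_sum]
  refine Finset.sum_congr rfl fun u _ => ?_
  rw [Finset.mul_sum]
  refine Finset.sum_congr rfl fun b _ => ?_
  rw [singleShotEstimate_eq hO, Complex.real_smul, Complex.ofReal_mul,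
    ← posSemidef_apply_eq_ofReal, Complex.ofReal_inv, Complex.ofReal_natCast, mul_assoc]
  rfl

theorem integral_norm_singleShotEstimate_sq {n k : ℕ} {S : Fin k → StabilizerCode n 1}
    {O : Op n k} (hO : IsLogicalPauli S O) (ρ : DensityMatrix (Fin k → Bits n)) :
    ∫ s, ‖singleShotEstimate S O s‖ ^ 2 ∂(shotLaw ρ).toMeasure =
      shadowSecondMoment ρ (codeProjector S * O) := by
  rw [integral_shotLaw, shadowSecondMoment, Finset.mul_sum]
  refine Finset.sum_congr rfl fun u _ => ?_
  rw [Finset.mul_sum]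
  refine Finset.sum_congr rfl fun b _ => ?_
  rw [singleShotEstimate_eq hO, smul_eq_mul, mul_assoc]

theorem integral_norm_singleShotEstimate_sq_le {n k : ℕ} {S : Fin k → StabilizerCode n 1}
    {O : Op n k} (hO : IsLogicalPauli S O) (ρ : DensityMatrix (Fin k → Bits n)) :
    ∫ s, ‖singleShotEstimate S O s‖ ^ 2 ∂(shotLaw ρ).toMeasure ≤ 4 ^ k :=
  (integral_norm_singleShotEstimate_sq hO ρ).trans_le (shadowSecondMoment_le_four_pow S hO ρ)

/-! ### Sample complexity -/

theorem sampleMeanEstimate_eq {n k N : ℕ} (S : Fin k → StabilizerCode n 1) (O : Op n k)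
    (ω : Fin N → Shot n k) : sampleMeanEstimate S O ω =
      finsetMean Finset.univ fun s => singleShotEstimate S O (ω s) := by
  rw [sampleMeanEstimate, finsetMean, Finset.card_univ, Fintype.card_fin]

instance samplesLaw_isProbabilityMeasure {n k : ℕ} (ρ : DensityMatrix (Fin k → Bits n)) (N : ℕ) :
    IsProbabilityMeasure (samplesLaw ρ N) := by
  unfold samplesLaw
  infer_instance

theorem samplesLaw_sampleMeanEstimate_le {n k M N : ℕ} {S : Fin k → StabilizerCode n 1}
    {O : Op n k} (hO : IsLogicalPauli S O) {ε δ : ℝ} (hε : 0 < ε) (hδ : 0 < δ)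
    (hN : 1000 * (Real.log (max M 2 : ℕ) * 4 ^ k / (ε * δ ^ 2)) ≤ N)
    (ρ : DensityMatrix (Fin k → Bits n)) :
    samplesLaw ρ N {ω | δ ≤ ‖sampleMeanEstimate S O ω -
      (codeProjector S * ρ.mat * codeProjector S * O).trace‖} ≤ ENNReal.ofReal ε := by
  have hlog : 1 / 2 ≤ Real.log (max M 2 : ℕ) := by
    have h1 : Real.log 2 ≤ Real.log (max M 2 : ℕ) :=
      Real.log_le_log (by norm_num) (by exact_mod_cast le_max_right M 2)
    have h2 := Real.log_two_gt_d9
    linarith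
  -- Chebyshev for a single observable needs no logarithm; the factor `1000 log` exceeds one.
  have hN2 : (4 : ℝ) ^ k / (ε * δ ^ 2) ≤ N := by
    refine le_trans ?_ hN
    rw [mul_div_assoc]
    have h3 : 0 ≤ (4 : ℝ) ^ k / (ε * δ ^ 2) := by positivity
    nlinarith
  have hNpos : 0 < (N : ℝ) := lt_of_lt_of_le (by positivity) hN2
  have hne : (Finset.univ : Finset (Fin N)).Nonempty := by
    rw [← Finset.card_pos, Finset.card_univ, Fintype.card_fin]
    exact_mod_cast hNpos
  have h := measure_finsetMean_le (shotLaw ρ).toMeasure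
    (integral_norm_singleShotEstimate_sq_le hO ρ) hne hδ
  rw [integral_singleShotEstimate hO, Finset.card_univ, Fintype.card_fin] at h
  simp only [sampleMeanEstimate_eq]
  refine h.trans (ENNReal.ofReal_le_ofReal ?_)
  rw [div_le_iff₀ (by positivity)] at hN2 ⊢
  linarith

theorem exists_simultaneous_estimate {n k M N : ℕ} {S : Fin k → StabilizerCode n 1}
    {O : Fin M → Op n k} (hO : ∀ i, IsLogicalPauli S (O i)) {ε δ : ℝ} (hε : 0 < ε) (hδ : 0 < δ)
    (hN : 1000 * (Real.log (max M 2 : ℕ) * 4 ^ k / (ε * δ ^ 2)) ≤ N) :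
    ∃ f : (Fin N → ℂ) → ℂ, ∀ ρ : DensityMatrix (Fin k → Bits n),
      samplesLaw ρ N {ω | ∃ i, δ ≤ ‖f (fun s => singleShotEstimate S (O i) (ω s)) -
        (codeProjector S * ρ.mat * codeProjector S * O i).trace‖} ≤ ENNReal.ofReal ε := by
  -- The group sizes require `ε ≤ 1` and `δ ≤ 1`. Beyond these the constant estimate `0` works, by
  -- triviality of the probability bound or because true values have modulus at most one.
  rcases lt_or_ge 1 ε with hε1 | hε1
  · refine ⟨fun _ => 0, fun ρ => prob_le_one.trans ?_⟩
    rw [← ENNReal.ofReal_one]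
    exact ENNReal.ofReal_le_ofReal hε1.le
  rcases lt_or_ge 1 δ with hδ1 | hδ1
  · refine ⟨fun _ => 0, fun ρ => ?_⟩
    rw [Set.eq_empty_of_forall_notMem (s := {ω | _})]
    · simp
    · rintro ω ⟨i, hi⟩
      rw [zero_sub, norm_neg] at hi
      exact absurd (hi.trans (norm_trace_codeProjector_conj_le (hO i) ρ)) (not_le.2 hδ1)
  obtain ⟨K, m, hm, hKm, hK, hmV⟩ :=
    exists_group_sizes (V := 4 ^ k) (one_le_pow₀ (by norm_num)) hε hε1 hδ hδ1 hN
  let T : Fin K → Finset (Fin N) := fun g => consecutiveGroup N m g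
  have hTcard : ∀ g, m ≤ (T g).card := fun g => le_card_consecutiveGroup hKm g.2
  refine ⟨majorityEstimate T δ, fun ρ => ?_⟩
  have hone : ∀ i, samplesLaw ρ N {ω | δ ≤ ‖majorityEstimate T δ
      (fun s => singleShotEstimate S (O i) (ω s)) -
        (codeProjector S * ρ.mat * codeProjector S * O i).trace‖} ≤
      ENNReal.ofReal ((1 / 2) ^ K) := by
    intro i
    rw [← integral_singleShotEstimate (hO i)]
    refine measure_majorityEstimate_le _ (integral_norm_singleShotEstimate_sq_le (hO i) ρ) hδ
      (fun g h hgh => disjoint_consecutiveGroup fun h' => hgh (Fin.ext h'))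
      (fun g => Finset.card_pos.1 (hm.trans_le (hTcard g))) fun g => hmV.trans ?_
    exact mul_le_mul_of_nonneg_right (by exact_mod_cast hTcard g) (by positivity)
  rw [Set.ofPred_exists]
  -- Union bound over the `M` observables; `K` was chosen so that `M / 2 ^ K ≤ ε`.
  refine (measure_iUnion_fintype_le _ _).trans ((Finset.sum_le_sum fun i _ => hone i).trans ?_)
  rw [Finset.sum_const, Finset.card_univ, Fintype.card_fin, ← ENNReal.ofReal_nsmul, nsmul_eq_mul]
  exact ENNReal.ofReal_le_ofReal hK

end LST

theorem mainTheorem1 :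
    (∀ n k : ℕ, IsUnit (LST.shadowChannel n k)) ∧
    (∀ (n k : ℕ) (S : Fin k → LST.StabilizerCode n 1) (O : LST.Op n k),
      LST.IsLogicalPauli S O →
        LST.shadowNorm (LST.codeProjector S * O) ^ 2 ≤
          ((2 * 2 ^ n + 2) / (2 ^ n + 2) * 2 : ℝ) ^ k) ∧
    ∃ C : ℝ, 0 < C ∧
      ∀ (n k M : ℕ) (S : Fin k → LST.StabilizerCode n 1) (O : Fin M → LST.Op n k),
        (∀ i, LST.IsLogicalPauli S (O i)) →
        ∀ ε δ : ℝ, 0 < ε → 0 < δ →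
        ∀ N : ℕ, C * (Real.log (max M 2 : ℕ) * 4 ^ k / (ε * δ ^ 2)) ≤ N →
          (∀ (ρ : LST.DensityMatrix (Fin k → LST.Bits n)) (i : Fin M),
            LST.samplesLaw ρ N {ω | δ ≤ ‖LST.sampleMeanEstimate S (O i) ω -
              (LST.codeProjector S * ρ.mat * LST.codeProjector S * O i).trace‖}
              ≤ ENNReal.ofReal ε) ∧
          ∃ f : (Fin N → ℂ) → ℂ,
            ∀ ρ : LST.DensityMatrix (Fin k → LST.Bits n),
              LST.samplesLaw ρ N {ω | ∃ i, δ ≤ ‖f (fun s => LST.singleShotEstimate S (O i) (ω s)) -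
                (LST.codeProjector S * ρ.mat * LST.codeProjector S * O i).trace‖}
                ≤ ENNReal.ofReal ε :=
  ⟨LST.isUnit_shadowChannel,
    fun _ _ S _ hO => LST.shadowNorm_codeProjector_mul_sq_le S hO,
    1000, by norm_num, fun _ _ _ _ _ hO _ _ hε hδ _ hN =>
      ⟨fun ρ i => LST.samplesLaw_sampleMeanEstimate_le (hO i) hε hδ hN ρ,
        LST.exists_simultaneous_estimate hO hε hδ hN⟩⟩
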